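/- **Notation.** Let $B_N$ be the Artin braid group with standard generators $\sigma_1,\dots,\sigma_{N-1}$ ($B_N$ is trivial for $N\le 1$), and let $\widehat B_N$ be its profinite completion. Write $b(k)$ for the image of $k$ under the permutation of $b\in\widehat B_l$ given by the projection $\widehat B_l\to\mathfrak S_l$, $\sigma_i\mapsto(i,i+1)$; thus $(bb')(k)=b(b'(k))$, and in a picture $bb'$ has $b$ on top of $b'$. For $1\le i<j\le N$ put $$x_{i,j}=(\sigma_{j-1}\cdots\sigma_{i+1})\,\sigma_i^2\,(\sigma_{j-1}\cdots\sigma_{i+1})^{-1},$$ and for consecutive integers $A=\{a,\dots,a'\}$ and $C=\{c,\dots,c'\}$ with $a'<c$ put $x_{A,C}=\prod_{i\in A}\prod_{j\in C}x_{i,j}$ (lexicographic order). Let $\widehat F_2$ be the free profinite group on $x,y$. For $f\in\widehat F_2$ let $f(\alpha,\beta)$ be its image under the continuous homomorphism $x\mapsto\alpha$, $y\mapsto\beta$, and for successive blocks $A,C,D$ of consecutive integers let $f_{A,C,D}=f(x_{A,C},x_{C,D})$, which is read as $1$ if $A=\emptyset$. For $m_1,m_2\ge 0$ and $n\ge 1$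 put $$f_{[m_1],[n],[m_2]}=f_{1\cdots m_1,\;m_1+1\cdots m_1+n-1,\;m_1+n}\cdots f_{1\cdots m_1,\;m_1+1\,m_1+2,\;m_1+3}\cdot f_{1\cdots m_1,\;m_1+1,\;m_1+2}\in\widehat B_{m_1+n+m_2}.$$ **The group and its action.** $\widehat{GT}$ is the group of topological automorphisms $\sigma$ of $\widehat F_2$ of the form $x\mapsto x^\lambda$, $y\mapsto f^{-1}y^\lambda f$ with $(\lambda,f)\in\widehat{\mathbb Z}^\times\times\widehat F_2$ such that $f(x,y)f(y,x)=1$; $f(z,x)z^mf(y,z)y^mf(x,y)x^m=1$ with $z=(xy)^{-1}$ and $m=(\lambda-1)/2$; and $f_{1,2,34}\,f_{12,3,4}=f_{2,3,4}\,f_{1,23,4}\,f_{1,2,3}$ in $\widehat B_4$. One writes $\sigma=(\lambda,f)$. It acts on every $\widehat B_N$ through the continuous homomorphism $b\mapsto\sigma(b)$ determined by $$\sigma(\sigma_i)=f_{1\cdots i-1,\,i,\,i+1}^{-1}\;\sigma_i^\lambda\; f_{1\cdots i-1,\,i,\,i+1}\qquad(1\le i\le N-1),$$ which exists. **Cabling.**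 Let $l,n\ge1$. For $1\le k\le l$ and $b\in\widehat B_l$ let $ev_{k,e_n}(b)\in\widehat B_{l+n-1}$ (resp. $ev^{k,e_n}(b)$) be obtained by replacing with $n$ parallel strings the string of $b$ which is the $k$-th from the left at the bottom (resp. at the top). These are the continuous maps with $ev_{k,e_n}(bb')=ev_{b'(k),e_n}(b)\cdot ev_{k,e_n}(b')$ and $ev^{b(k),e_n}(b)=ev_{k,e_n}(b)$, whose values on generators are $ev_{k,e_n}(\sigma_i)=\sigma_{i+n-1}$ if $k<i$; $\sigma_i\sigma_{i+1}\cdots\sigma_{i+n-1}$ if $k=i$; $\sigma_{i+n-1}\cdots\sigma_{i+1}\sigma_i$ if $k=i+1$; and $\sigma_i$ if $k>i+1$. **Proposition.** Let $\sigma=(\lambda,f)\in\widehat{GT}$, let $l,n\ge1$, $1\le k\le l$, $b\in\widehat B_l$, and $k'=b(k)$. Then $$\sigma(ev_{k,e_n}(b))=f_{[k'-1],[n],[l-k']}^{-1}\cdot ev_{k,e_n}(\sigma(b))\cdot f_{[k-1],[n],[l-k]},$$ $$\sigma(ev^{k',e_n}(b))=f_{[k'-1],[n],[l-k']}^{-1}\cdot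 ev^{k',e_n}(\sigma(b))\cdot f_{[k-1],[n],[l-k]}$$ in $\widehat B_{l+n-1}$. -/

import Mathlib

/-! ### Profinite completions, profinite integers and profinite powers -/

/-- The profinite completion of a group, as a profinite group. -/
abbrev Hat (G : Type) [Group G] : ProfiniteGrp.{0} :=
  ProfiniteGrp.ProfiniteCompletion.completion (GrpCat.of G)

namespace Hat

/-- The natural homomorphism from a group to its profinite completion. -/
def ofGroup (G : Type) [Group G] : G →* Hat G :=
  (ProfiniteGrp.ProfiniteCompletion.eta (GrpCat.of G)).hom

/-- The continuous extension to the profinite completion of a homomorphism to a profinite group. -/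
noncomputable def extend {G : Type} [Group G] {P : ProfiniteGrp.{0}} (φ : G →* P) : Hat G →ₜ* P :=
  (ProfiniteGrp.ProfiniteCompletion.lift (G := GrpCat.of G) (GrpCat.ofHom φ)).hom

end Hat

/-- The ring of profinite integers, `lim ℤ/n` over `n ≥ 1` ordered by divisibility. -/
def ZHat : Subring (∀ n : ℕ+, ZMod n) where
  carrier := {a | ∀ (m n : ℕ+) (h : (m : ℕ) ∣ n), ZMod.castHom h (ZMod m) (a n) = a m}
  mul_mem' := fun {a b} ha hb m n h => by
    rw [Pi.mul_apply, map_mul, ha m n h, hb m n h, Pi.mul_apply]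
  one_mem' := fun m n h => by rw [Pi.one_apply, map_one, Pi.one_apply]
  add_mem' := fun {a b} ha hb m n h => by
    rw [Pi.add_apply, map_add, ha m n h, hb m n h, Pi.add_apply]
  zero_mem' := fun m n h => by rw [Pi.zero_apply, map_zero, Pi.zero_apply]
  neg_mem' := fun {a} ha m n h => by
    rw [Pi.neg_apply, map_neg, ha m n h, Pi.neg_apply]

namespace Hat

variable {G : Type} [Group G]

/-- The order of the finite quotient `G ⧸ N`. -/
noncomputable def quotCard (N : FiniteIndexNormalSubgroup G) : ℕ+ :=
  ⟨Nat.card (G ⧸ N.toSubgroup), Nat.card_pos⟩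

/-- The power `g ^ c` of an element of a profinite completion, for a profinite integer `c`:
in each finite quotient `G ⧸ N` it is the power with exponent `c` modulo `|G ⧸ N|`. -/
noncomputable def zpow (g : Hat G) (c : ZHat) : Hat G :=
  ⟨fun N => (g.1 N : G ⧸ N.toSubgroup) ^ (c.1 (quotCard N)).val, fun N M π => by
    have hd : ((quotCard M : ℕ+) : ℕ) ∣ quotCard N :=
      Subgroup.index_dvd_of_le (show N.toSubgroup ≤ M.toSubgroup from π.le)
    have hc := c.2 _ _ hd
    rw [ZMod.castHom_apply, ZMod.cast_eq_val] at hc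
    have key : ∀ q : G ⧸ M.toSubgroup, q ^ (c.1 (quotCard N)).val = q ^ (c.1 (quotCard M)).val := by
      intro q
      rw [← hc, ZMod.val_natCast]
      exact (pow_mod_natCard q _).symm
    refine Eq.trans (map_pow (ProfiniteGrp.Hom.hom
      ((ProfiniteGrp.ProfiniteCompletion.diagram (GrpCat.of G)).map π)) (g.1 N) _) ?_
    refine Eq.trans (key _) ?_
    exact congrArg (fun q : G ⧸ M.toSubgroup => q ^ (c.1 (quotCard M)).val) (g.2 π)⟩

end Hat

/-! ### Braid groups -/

/-- The Artin relations between the generators `σ_i`, `1 ≤ i ≤ n - 1`. -/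
def braidRels (n : ℕ) : Set (FreeGroup {i : ℕ // 1 ≤ i ∧ i < n}) :=
  {r | (∃ i j : {i : ℕ // 1 ≤ i ∧ i < n}, (j : ℕ) = i + 1 ∧
        r = FreeGroup.of i * FreeGroup.of j * FreeGroup.of i *
          (FreeGroup.of j * FreeGroup.of i * FreeGroup.of j)⁻¹) ∨
      (∃ i j : {i : ℕ // 1 ≤ i ∧ i < n}, (i : ℕ) + 1 < j ∧
        r = FreeGroup.of i * FreeGroup.of j * (FreeGroup.of j * FreeGroup.of i)⁻¹)}

/-- The Artin braid group `B_n` with `n` strings; it is trivial for `n ≤ 1`. -/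
abbrev Braid (n : ℕ) : Type := PresentedGroup (braidRels n)

namespace Braid

/-- The generator `σ_i` of `B_n` for `1 ≤ i ≤ n - 1` (and, by convention, `1` for other `i`). -/
def sigma (n i : ℕ) : Braid n :=
  if h : 1 ≤ i ∧ i < n then PresentedGroup.of ⟨i, h⟩ else 1

/-- `σ_a σ_{a+1} ⋯ σ_{a+m-1}`. -/
def up (n a m : ℕ) : Braid n := ((List.range m).map fun t => sigma n (a + t)).prod

/-- `σ_{a+m-1} ⋯ σ_{a+1} σ_a`. -/
def down (n a m : ℕ) : Braid n := ((List.range m).map fun t => sigma n (a + t)).reverse.prod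

/-- The pure braid `x_{i,j} = (σ_{j-1} ⋯ σ_{i+1}) σ_i² (σ_{j-1} ⋯ σ_{i+1})⁻¹`, `1 ≤ i < j ≤ n`. -/
def x (n i j : ℕ) : Braid n :=
  down n (i + 1) (j - 1 - i) * sigma n i ^ 2 * (down n (i + 1) (j - 1 - i))⁻¹

/-- The pure braid `x_{a⋯a+p-1, b⋯b+q-1}`, the product of the `x_{i,j}` with `a ≤ i < a + p` and
`b ≤ j < b + q` in lexicographic order of `(i, j)`. -/
def xBlock (n a p b q : ℕ) : Braid n :=
  ((List.range p).map fun s => ((List.range q).map fun t => x n (a + s) (b + t)).prod).prod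

lemma sigma_braid {n i : ℕ} (h1 : 1 ≤ i) (h2 : i + 1 < n) :
    sigma n i * sigma n (i + 1) * sigma n i =
      sigma n (i + 1) * sigma n i * sigma n (i + 1) := by
  have hi : 1 ≤ i ∧ i < n := ⟨h1, by omega⟩
  have hj : 1 ≤ i + 1 ∧ i + 1 < n := ⟨by omega, h2⟩
  simp only [sigma, dif_pos hi, dif_pos hj]
  rw [← mul_inv_eq_one]
  exact PresentedGroup.one_of_mem (rels := braidRels n) (Or.inl ⟨⟨i, hi⟩, ⟨i + 1, hj⟩, rfl, rfl⟩)

lemma sigma_comm {n i j : ℕ} (h : i + 1 < j) : Commute (sigma n i) (sigma n j) := by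
  by_cases hi : 1 ≤ i ∧ i < n
  · by_cases hj : 1 ≤ j ∧ j < n
    · simp only [sigma, dif_pos hi, dif_pos hj]
      change _ * _ = _ * _
      rw [← mul_inv_eq_one]
      exact PresentedGroup.one_of_mem (rels := braidRels n) (Or.inr ⟨⟨i, hi⟩, ⟨j, hj⟩, h, rfl⟩)
    · simp [sigma, dif_neg hj]
  · simp [sigma, dif_neg hi]

lemma up_succ (n a m : ℕ) : up n a (m + 1) = up n a m * sigma n (a + m) := by
  simp [up, List.range_succ]

lemma down_succ (n a m : ℕ) : down n a (m + 1) = sigma n (a + m) * down n a m := by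
  simp [down, List.range_succ]

@[simp] lemma up_zero (n a : ℕ) : up n a 0 = 1 := rfl

@[simp] lemma down_zero (n a : ℕ) : down n a 0 = 1 := rfl

lemma up_comm_of_lt {n a m j : ℕ} (h : a + m < j) : Commute (up n a m) (sigma n j) := by
  induction m with
  | zero => simp
  | succ m ih =>
    rw [up_succ]
    exact (ih (by omega)).mul_left (sigma_comm (by omega))

lemma up_comm_of_gt {n a m j : ℕ} (h : j + 1 < a) : Commute (up n a m) (sigma n j) := by
  induction m with
  | zero => simp
  | succ m ih =>
    rw [up_succ]
    exact ih.mul_left (sigma_comm (by omega)).symm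

lemma down_comm_of_lt {n a m j : ℕ} (h : a + m < j) : Commute (down n a m) (sigma n j) := by
  induction m with
  | zero => simp
  | succ m ih =>
    rw [down_succ]
    exact (sigma_comm (by omega) : Commute _ _).mul_left (ih (by omega))

lemma down_comm_of_gt {n a m j : ℕ} (h : j + 1 < a) : Commute (down n a m) (sigma n j) := by
  induction m with
  | zero => simp
  | succ m ih =>
    rw [down_succ]
    exact (sigma_comm (by omega) : Commute _ _).symm.mul_left ih

lemma down_down {n a m : ℕ} (ha : 1 ≤ a) (h : a + m < n) :
    down n a m * down n (a + 1) m * sigma n a = sigma n (a + m) * (down n a m * down n (a + 1) m) := by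
  induction m with
  | zero => simp
  | succ m ih =>
    have e : a + 1 + m = a + m + 1 := by omega
    have h1 : down n a m * sigma n (a + m + 1) = sigma n (a + m + 1) * down n a m :=
      (down_comm_of_lt (by omega)).eq
    have h2 := sigma_braid (n := n) (i := a + m) (by omega) (by omega)
    rw [down_succ, down_succ, e, ← add_assoc]
    calc sigma n (a + m) * down n a m * (sigma n (a + m + 1) * down n (a + 1) m) * sigma n a
        = sigma n (a + m) * (down n a m * sigma n (a + m + 1)) *
            down n (a + 1) m * sigma n a := by group
      _ = sigma n (a + m) * sigma n (a + m + 1) *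
            (down n a m * down n (a + 1) m * sigma n a) := by rw [h1]; group
      _ = (sigma n (a + m) * sigma n (a + m + 1) * sigma n (a + m)) *
            down n a m * down n (a + 1) m := by rw [ih (by omega)]; group
      _ = sigma n (a + m + 1) * sigma n (a + m) * (sigma n (a + m + 1) * down n a m) *
            down n (a + 1) m := by rw [h2]; group
      _ = _ := by rw [← h1]; group

lemma up_up {n a m : ℕ} (ha : 1 ≤ a) (h : a + m < n) :
    sigma n a * (up n (a + 1) m * up n a m) = up n (a + 1) m * up n a m * sigma n (a + m) := by
  induction m with
  | zero => simp
  | succ m ih =>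
    have e : a + 1 + m = a + m + 1 := by omega
    have h1 : up n a m * sigma n (a + m + 1) = sigma n (a + m + 1) * up n a m :=
      (up_comm_of_lt (by omega)).eq
    have h2 := sigma_braid (n := n) (i := a + m) (by omega) (by omega)
    rw [up_succ, up_succ, e, ← add_assoc]
    calc sigma n a * (up n (a + 1) m * sigma n (a + m + 1) * (up n a m * sigma n (a + m)))
        = sigma n a * up n (a + 1) m * (sigma n (a + m + 1) * up n a m) * sigma n (a + m) := by
          group
      _ = (sigma n a * (up n (a + 1) m * up n a m)) * sigma n (a + m + 1) * sigma n (a + m) := by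
          rw [← h1]; group
      _ = up n (a + 1) m * up n a m * (sigma n (a + m) * sigma n (a + m + 1) * sigma n (a + m)) := by
          rw [ih (by omega)]; group
      _ = up n (a + 1) m * (up n a m * sigma n (a + m + 1)) * sigma n (a + m) *
            sigma n (a + m + 1) := by rw [h2]; group
      _ = _ := by rw [h1]; group

lemma up_down {n a m : ℕ} (ha : 1 ≤ a) (h : a + m < n) :
    up n a m * sigma n (a + m) * down n a m =
      down n (a + 1) m * sigma n a * up n (a + 1) m := by
  induction m with
  | zero => simp
  | succ m ih =>
    have e : a + 1 + m = a + m + 1 := by omega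
    have h1 : up n a m * sigma n (a + m + 1) = sigma n (a + m + 1) * up n a m :=
      (up_comm_of_lt (by omega)).eq
    have h1' : down n a m * sigma n (a + m + 1) = sigma n (a + m + 1) * down n a m :=
      (down_comm_of_lt (by omega)).eq
    have h2 := sigma_braid (n := n) (i := a + m) (by omega) (by omega)
    rw [up_succ, down_succ, down_succ, up_succ, e, ← add_assoc]
    calc up n a m * sigma n (a + m) * sigma n (a + m + 1) * (sigma n (a + m) * down n a m)
        = up n a m * (sigma n (a + m) * sigma n (a + m + 1) * sigma n (a + m)) * down n a m := by
          group
      _ = (up n a m * sigma n (a + m + 1)) * sigma n (a + m) *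
            (sigma n (a + m + 1) * down n a m) := by rw [h2]; group
      _ = sigma n (a + m + 1) * (up n a m * sigma n (a + m) * down n a m) *
            sigma n (a + m + 1) := by rw [h1, ← h1']; group
      _ = _ := by rw [ih (by omega)]; group

end Braid

/-! ### Permutations and cabling of profinite braids -/

section Cabling

open Equiv

/-- Strands of a braid with `l` strings are labelled by `Fin l`, so that the string number `k`
(counted from the left, starting with `1`) has label `k - 1`. -/
def Braid.swapAt (l : ℕ) (i : {i : ℕ // 1 ≤ i ∧ i < l}) : Perm (Fin l) :=
  swap ⟨i - 1, by omega⟩ ⟨i, i.2.2⟩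

/-- The group `H ^ l ⋊ S_l`, with `(u, π) (v, ρ) = (j ↦ u j * v (π⁻¹ j), π ρ)`. -/
abbrev Cables (l : ℕ) (H : Type) [Group H] : Type := (Fin l → H) ⋊[mulAutArrow] Perm (Fin l)

/-- The result of replacing one string of `σ_i` in `B_l` by `n` parallel strings, namely the string
which ends at the position with label `j` on the top. -/
def Braid.cableSigma (l n : ℕ) (i : {i : ℕ // 1 ≤ i ∧ i < l}) (j : Fin l) : Braid (l + n - 1) :=
  if (j : ℕ) + 1 < i then Braid.sigma (l + n - 1) (i + n - 1)
  else if (j : ℕ) + 1 = i then Braid.down (l + n - 1) i n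
  else if (j : ℕ) = i then Braid.up (l + n - 1) i n
  else Braid.sigma (l + n - 1) i

/-- The generator `σ_i` together with all its cablings. -/
def Braid.cableGen (l n : ℕ) (i : {i : ℕ // 1 ≤ i ∧ i < l}) : Cables l (Braid (l + n - 1)) :=
  ⟨Braid.cableSigma l n i, Braid.swapAt l i⟩

namespace Braid

lemma swapAt_val_of_lt {l : ℕ} {i : {i : ℕ // 1 ≤ i ∧ i < l}} {j : Fin l} (h : (j : ℕ) + 1 < i) :
    ((swapAt l i j : Fin l) : ℕ) = j := by
  rw [swapAt, swap_apply_of_ne_of_ne] <;> simp only [ne_eq, Fin.ext_iff] <;> omega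

lemma swapAt_val_of_gt {l : ℕ} {i : {i : ℕ // 1 ≤ i ∧ i < l}} {j : Fin l} (h : (i : ℕ) < j) :
    ((swapAt l i j : Fin l) : ℕ) = j := by
  rw [swapAt, swap_apply_of_ne_of_ne] <;> simp only [ne_eq, Fin.ext_iff] <;> omega

lemma swapAt_val_left {l : ℕ} {i : {i : ℕ // 1 ≤ i ∧ i < l}} {j : Fin l} (h : (j : ℕ) + 1 = i) :
    ((swapAt l i j : Fin l) : ℕ) = i := by
  have : j = ⟨i - 1, by omega⟩ := Fin.ext (by simp only; omega)
  rw [this, swapAt, swap_apply_left]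

lemma swapAt_val_right {l : ℕ} {i : {i : ℕ // 1 ≤ i ∧ i < l}} {j : Fin l} (h : (j : ℕ) = i) :
    ((swapAt l i j : Fin l) : ℕ) + 1 = i := by
  have : j = ⟨i, i.2.2⟩ := Fin.ext h
  rw [this, swapAt, swap_apply_right]
  have := i.2.1
  simp only
  omega

lemma cableSigma_of_lt {l n : ℕ} {i : {i : ℕ // 1 ≤ i ∧ i < l}} {j : Fin l}
    (h : (j : ℕ) + 1 < i) : cableSigma l n i j = sigma (l + n - 1) (i + n - 1) := if_pos h

lemma cableSigma_left {l n : ℕ} {i : {i : ℕ // 1 ≤ i ∧ i < l}} {j : Fin l}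
    (h : (j : ℕ) + 1 = i) : cableSigma l n i j = down (l + n - 1) i n := by
  rw [cableSigma, if_neg (by omega), if_pos h]

lemma cableSigma_right {l n : ℕ} {i : {i : ℕ // 1 ≤ i ∧ i < l}} {j : Fin l}
    (h : (j : ℕ) = i) : cableSigma l n i j = up (l + n - 1) i n := by
  rw [cableSigma, if_neg (by omega), if_neg (by omega), if_pos h]

lemma cableSigma_of_gt {l n : ℕ} {i : {i : ℕ // 1 ≤ i ∧ i < l}} {j : Fin l}
    (h : (i : ℕ) < j) : cableSigma l n i j = sigma (l + n - 1) i := by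
  rw [cableSigma, if_neg (by omega), if_neg (by omega), if_neg (by omega)]

lemma cableGen_braid {l n : ℕ} (hn : 1 ≤ n) (i j : {i : ℕ // 1 ≤ i ∧ i < l})
    (h : (j : ℕ) = i + 1) :
    cableGen l n i * cableGen l n j * cableGen l n i =
      cableGen l n j * cableGen l n i * cableGen l n j := by
  have hi := i.2
  have hj := j.2
  have hs : ∀ (i : {i : ℕ // 1 ≤ i ∧ i < l}), (swapAt l i)⁻¹ = swapAt l i := fun _ => swap_inv _ _
  suffices H : ∀ p : Fin l,
      cableSigma l n i p * cableSigma l n j (swapAt l i p) *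
          cableSigma l n i (swapAt l j (swapAt l i p)) =
        cableSigma l n j p * cableSigma l n i (swapAt l j p) *
          cableSigma l n j (swapAt l i (swapAt l j p)) ∧
      ((swapAt l i (swapAt l j (swapAt l i p)) : Fin l) : ℕ) =
        (swapAt l j (swapAt l i (swapAt l j p)) : Fin l) by
    refine SemidirectProduct.ext (funext fun p => ?_) (Equiv.ext fun p => Fin.ext (H p).2)
    have := (H p).1
    rw [← hs i, ← hs j] at this
    exact this
  intro p
  rcases lt_trichotomy ((p : ℕ) + 1) i with hp | hp | hp
  · have a1 := swapAt_val_of_lt hp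
    have a2 := swapAt_val_of_lt (i := j) (j := p) (by omega)
    have a3 := swapAt_val_of_lt (i := j) (j := swapAt l i p) (by omega)
    have a4 := swapAt_val_of_lt (i := i) (j := swapAt l j p) (by omega)
    have a5 := swapAt_val_of_lt (i := i) (j := swapAt l j (swapAt l i p)) (by omega)
    have a6 := swapAt_val_of_lt (i := j) (j := swapAt l i (swapAt l j p)) (by omega)
    refine ⟨?_, by omega⟩
    rw [cableSigma_of_lt hp, cableSigma_of_lt (j := swapAt l i p) (by omega),
      cableSigma_of_lt (j := swapAt l j (swapAt l i p)) (by omega),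
      cableSigma_of_lt (j := p) (by omega), cableSigma_of_lt (j := swapAt l j p) (by omega),
      cableSigma_of_lt (j := swapAt l i (swapAt l j p)) (by omega),
      show (j : ℕ) + n - 1 = (i + n - 1) + 1 by omega]
    exact sigma_braid (by omega) (by omega)
  · have a1 := swapAt_val_left hp
    have a2 := swapAt_val_of_lt (i := j) (j := p) (by omega)
    have a3 := swapAt_val_left (i := j) (j := swapAt l i p) (by omega)
    have a4 := swapAt_val_left (i := i) (j := swapAt l j p) (by omega)
    have a5 := swapAt_val_of_gt (i := i) (j := swapAt l j (swapAt l i p)) (by omega)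
    have a6 := swapAt_val_left (i := j) (j := swapAt l i (swapAt l j p)) (by omega)
    refine ⟨?_, by omega⟩
    rw [cableSigma_left hp, cableSigma_left (j := swapAt l i p) (by omega),
      cableSigma_of_gt (j := swapAt l j (swapAt l i p)) (by omega),
      cableSigma_of_lt (j := p) (by omega), cableSigma_left (j := swapAt l j p) (by omega),
      cableSigma_left (j := swapAt l i (swapAt l j p)) (by omega), h,
      show (i : ℕ) + 1 + n - 1 = i + n by omega, mul_assoc (sigma _ _)]
    exact down_down (by omega) (by omega)
  · rcases lt_trichotomy (p : ℕ) j with hp' | hp' | hp'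
    · have a1 := swapAt_val_right (i := i) (j := p) (by omega)
      have a2 := swapAt_val_left (i := j) (j := p) (by omega)
      have a3 := swapAt_val_of_lt (i := j) (j := swapAt l i p) (by omega)
      have a4 := swapAt_val_of_gt (i := i) (j := swapAt l j p) (by omega)
      have a5 := swapAt_val_left (i := i) (j := swapAt l j (swapAt l i p)) (by omega)
      have a6 := swapAt_val_right (i := j) (j := swapAt l i (swapAt l j p)) (by omega)
      refine ⟨?_, by omega⟩
      rw [cableSigma_right (j := p) (by omega), cableSigma_of_lt (j := swapAt l i p) (by omega),
        cableSigma_left (j := swapAt l j (swapAt l i p)) (by omega),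
        cableSigma_left (j := p) (by omega), cableSigma_of_gt (j := swapAt l j p) (by omega),
        cableSigma_right (j := swapAt l i (swapAt l j p)) (by omega), h,
        show (i : ℕ) + 1 + n - 1 = i + n by omega]
      exact up_down (by omega) (by omega)
    · have a1 := swapAt_val_of_gt (i := i) (j := p) (by omega)
      have a2 := swapAt_val_right (i := j) (j := p) (by omega)
      have a3 := swapAt_val_right (i := j) (j := swapAt l i p) (by omega)
      have a4 := swapAt_val_right (i := i) (j := swapAt l j p) (by omega)
      have a5 := swapAt_val_right (i := i) (j := swapAt l j (swapAt l i p)) (by omega)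
      have a6 := swapAt_val_of_lt (i := j) (j := swapAt l i (swapAt l j p)) (by omega)
      refine ⟨?_, by omega⟩
      rw [cableSigma_of_gt (j := p) (by omega), cableSigma_right (j := swapAt l i p) (by omega),
        cableSigma_right (j := swapAt l j (swapAt l i p)) (by omega),
        cableSigma_right (j := p) (by omega), cableSigma_right (j := swapAt l j p) (by omega),
        cableSigma_of_lt (j := swapAt l i (swapAt l j p)) (by omega), h,
        show (i : ℕ) + 1 + n - 1 = i + n by omega, mul_assoc (sigma _ _)]
      exact up_up (by omega) (by omega)
    · have a1 := swapAt_val_of_gt (i := i) (j := p) (by omega)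
      have a2 := swapAt_val_of_gt (i := j) (j := p) (by omega)
      have a3 := swapAt_val_of_gt (i := j) (j := swapAt l i p) (by omega)
      have a4 := swapAt_val_of_gt (i := i) (j := swapAt l j p) (by omega)
      have a5 := swapAt_val_of_gt (i := i) (j := swapAt l j (swapAt l i p)) (by omega)
      have a6 := swapAt_val_of_gt (i := j) (j := swapAt l i (swapAt l j p)) (by omega)
      refine ⟨?_, by omega⟩
      rw [cableSigma_of_gt (j := p) (by omega), cableSigma_of_gt (j := swapAt l i p) (by omega),
        cableSigma_of_gt (j := swapAt l j (swapAt l i p)) (by omega),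
        cableSigma_of_gt (j := p) (by omega), cableSigma_of_gt (j := swapAt l j p) (by omega),
        cableSigma_of_gt (j := swapAt l i (swapAt l j p)) (by omega), h]
      exact sigma_braid (by omega) (by omega)

lemma cableGen_comm {l n : ℕ} (hn : 1 ≤ n) (i j : {i : ℕ // 1 ≤ i ∧ i < l})
    (h : (i : ℕ) + 1 < j) :
    cableGen l n i * cableGen l n j = cableGen l n j * cableGen l n i := by
  have hi := i.2
  have hj := j.2
  have hs : ∀ (i : {i : ℕ // 1 ≤ i ∧ i < l}), (swapAt l i)⁻¹ = swapAt l i := fun _ => swap_inv _ _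
  suffices H : ∀ p : Fin l,
      cableSigma l n i p * cableSigma l n j (swapAt l i p) =
        cableSigma l n j p * cableSigma l n i (swapAt l j p) ∧
      ((swapAt l i (swapAt l j p) : Fin l) : ℕ) = (swapAt l j (swapAt l i p) : Fin l) by
    refine SemidirectProduct.ext (funext fun p => ?_) (Equiv.ext fun p => Fin.ext (H p).2)
    have := (H p).1
    rw [← hs i, ← hs j] at this
    exact this
  intro p
  rcases lt_or_ge (p : ℕ) (i + 1) with hp | hp
  · have b1 := swapAt_val_of_lt (i := j) (j := p) (by omega)
    rw [cableSigma_of_lt (i := j) (j := p) (by omega)]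
    rcases lt_trichotomy ((p : ℕ) + 1) i with hp' | hp' | hp'
    · have a1 := swapAt_val_of_lt (i := i) (j := p) (by omega)
      have a2 := swapAt_val_of_lt (i := i) (j := swapAt l j p) (by omega)
      have a3 := swapAt_val_of_lt (i := j) (j := swapAt l i p) (by omega)
      refine ⟨?_, by omega⟩
      rw [cableSigma_of_lt (i := i) (j := p) (by omega),
        cableSigma_of_lt (i := j) (j := swapAt l i p) (by omega),
        cableSigma_of_lt (i := i) (j := swapAt l j p) (by omega)]
      exact (sigma_comm (by omega) : Commute _ _).eq
    · have a1 := swapAt_val_left (i := i) (j := p) (by omega)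
      have a2 := swapAt_val_left (i := i) (j := swapAt l j p) (by omega)
      have a3 := swapAt_val_of_lt (i := j) (j := swapAt l i p) (by omega)
      refine ⟨?_, by omega⟩
      rw [cableSigma_left (i := i) (j := p) (by omega),
        cableSigma_of_lt (i := j) (j := swapAt l i p) (by omega),
        cableSigma_left (i := i) (j := swapAt l j p) (by omega)]
      exact (down_comm_of_lt (by omega) : Commute _ _).eq
    · have a1 := swapAt_val_right (i := i) (j := p) (by omega)
      have a2 := swapAt_val_right (i := i) (j := swapAt l j p) (by omega)
      have a3 := swapAt_val_of_lt (i := j) (j := swapAt l i p) (by omega)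
      refine ⟨?_, by omega⟩
      rw [cableSigma_right (i := i) (j := p) (by omega),
        cableSigma_of_lt (i := j) (j := swapAt l i p) (by omega),
        cableSigma_right (i := i) (j := swapAt l j p) (by omega)]
      exact (up_comm_of_lt (by omega) : Commute _ _).eq
  · have b1 := swapAt_val_of_gt (i := i) (j := p) (by omega)
    rw [cableSigma_of_gt (i := i) (j := p) (by omega)]
    rcases lt_trichotomy ((p : ℕ) + 1) j with hp' | hp' | hp'
    · have a1 := swapAt_val_of_lt (i := j) (j := p) (by omega)
      have a2 := swapAt_val_of_lt (i := j) (j := swapAt l i p) (by omega)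
      have a3 := swapAt_val_of_gt (i := i) (j := swapAt l j p) (by omega)
      refine ⟨?_, by omega⟩
      rw [cableSigma_of_lt (i := j) (j := p) (by omega),
        cableSigma_of_lt (i := j) (j := swapAt l i p) (by omega),
        cableSigma_of_gt (i := i) (j := swapAt l j p) (by omega)]
      exact (sigma_comm (by omega) : Commute _ _).eq
    · have a1 := swapAt_val_left (i := j) (j := p) (by omega)
      have a2 := swapAt_val_left (i := j) (j := swapAt l i p) (by omega)
      have a3 := swapAt_val_of_gt (i := i) (j := swapAt l j p) (by omega)
      refine ⟨?_, by omega⟩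
      rw [cableSigma_left (i := j) (j := p) (by omega),
        cableSigma_left (i := j) (j := swapAt l i p) (by omega),
        cableSigma_of_gt (i := i) (j := swapAt l j p) (by omega)]
      exact (down_comm_of_gt (by omega) : Commute _ _).symm.eq
    · rcases lt_or_eq_of_le (show (j : ℕ) ≤ p by omega) with hq | hq
      · have a1 := swapAt_val_of_gt (i := j) (j := p) (by omega)
        have a2 := swapAt_val_of_gt (i := j) (j := swapAt l i p) (by omega)
        have a3 := swapAt_val_of_gt (i := i) (j := swapAt l j p) (by omega)
        refine ⟨?_, by omega⟩
        rw [cableSigma_of_gt (i := j) (j := p) (by omega),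
          cableSigma_of_gt (i := j) (j := swapAt l i p) (by omega),
          cableSigma_of_gt (i := i) (j := swapAt l j p) (by omega)]
        exact (sigma_comm (by omega) : Commute _ _).eq
      · have a1 := swapAt_val_right (i := j) (j := p) (by omega)
        have a2 := swapAt_val_right (i := j) (j := swapAt l i p) (by omega)
        have a3 := swapAt_val_of_gt (i := i) (j := swapAt l j p) (by omega)
        refine ⟨?_, by omega⟩
        rw [cableSigma_right (i := j) (j := p) (by omega),
          cableSigma_right (i := j) (j := swapAt l i p) (by omega),
          cableSigma_of_gt (i := i) (j := swapAt l j p) (by omega)]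
        exact (up_comm_of_gt (by omega) : Commute _ _).symm.eq

/-- The natural projection `B_l → S_l`, sending `σ_i` to the transposition `(i, i + 1)`. -/
def toPerm (l : ℕ) : Braid l →* Perm (Fin l) :=
  PresentedGroup.toGroup (f := swapAt l) (by
    have hb := fun i j h => congrArg SemidirectProduct.right (cableGen_braid (l := l) le_rfl i j h)
    have hc := fun i j h => congrArg SemidirectProduct.right (cableGen_comm (l := l) le_rfl i j h)
    rintro r (⟨i, j, h, rfl⟩ | ⟨i, j, h, rfl⟩)
    · simp only [map_mul, map_inv, FreeGroup.lift_apply_of]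
      exact mul_inv_eq_one.2 (hb i j h)
    · simp only [map_mul, map_inv, FreeGroup.lift_apply_of]
      exact mul_inv_eq_one.2 (hc i j h))

/-- The homomorphism from `B_l` to the group `(B_{l+n-1}) ^ l ⋊ S_l` which records all cablings of a
braid by `n` parallel strings, and its permutation. -/
def cable (l n : ℕ) (hn : 1 ≤ n) : Braid l →* Cables l (Braid (l + n - 1)) :=
  PresentedGroup.toGroup (f := cableGen l n) (by
    rintro r (⟨i, j, h, rfl⟩ | ⟨i, j, h, rfl⟩)
    · simp only [map_mul, map_inv, FreeGroup.lift_apply_of]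
      exact mul_inv_eq_one.2 (cableGen_braid hn i j h)
    · simp only [map_mul, map_inv, FreeGroup.lift_apply_of]
      exact mul_inv_eq_one.2 (cableGen_comm hn i j h))

end Braid

namespace Cables

/-- Functoriality of `H ^ l ⋊ S_l` in `H`. -/
def map (l : ℕ) {H K : Type} [Group H] [Group K] (φ : H →* K) : Cables l H →* Cables l K :=
  SemidirectProduct.map (MonoidHom.compLeft φ (Fin l)) (MonoidHom.id _) (fun _ => rfl)

/-- The topology on `H ^ l ⋊ S_l` is the product topology, `S_l` being discrete. -/
instance topology (l : ℕ) (H : Type) [Group H] [TopologicalSpace H] :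
    TopologicalSpace (Cables l H) :=
  letI : TopologicalSpace (Perm (Fin l)) := ⊥
  TopologicalSpace.induced (fun c => (c.left, c.right)) inferInstance

/-- The underlying space of `H ^ l ⋊ S_l` is the product space. -/
def homeo (l : ℕ) (H : Type) [Group H] [TopologicalSpace H] :
    letI : TopologicalSpace (Perm (Fin l)) := ⊥
    Cables l H ≃ₜ (Fin l → H) × Perm (Fin l) :=
  letI : TopologicalSpace (Perm (Fin l)) := ⊥
  SemidirectProduct.equivProd.toHomeomorphOfIsInducing ⟨rfl⟩

lemma continuous_apply_perm {l : ℕ} {H X : Type} [TopologicalSpace H] [TopologicalSpace X]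
    {f : X → Fin l → H} {g : X → Perm (Fin l)}
    (hf : Continuous f) (hg : @Continuous X _ _ ⊥ g) (j : Fin l) :
    Continuous fun a => f a ((g a)⁻¹ j) := by
  let _ : TopologicalSpace (Perm (Fin l)) := ⊥
  have _ : DiscreteTopology (Perm (Fin l)) := ⟨rfl⟩
  refine continuous_iff_continuousAt.2 fun a => ?_
  have h : (fun b => f b ((g a)⁻¹ j)) =ᶠ[nhds a] fun b => f b ((g b)⁻¹ j) := by
    filter_upwards [(hg.isOpen_preimage {g a} (isOpen_discrete _)).mem_nhds rfl] with b hb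
    rw [Set.mem_preimage, Set.mem_singleton_iff] at hb
    rw [hb]
  exact ((continuous_apply _).comp hf).continuousAt.congr h

variable (l : ℕ) (H : Type) [Group H] [TopologicalSpace H]

lemma continuous_left : Continuous (fun c : Cables l H => c.left) :=
  letI : TopologicalSpace (Perm (Fin l)) := ⊥
  continuous_fst.comp (homeo l H).continuous

lemma continuous_right :
    @Continuous (Cables l H) (Perm (Fin l)) _ ⊥ (fun c : Cables l H => c.right) :=
  letI : TopologicalSpace (Perm (Fin l)) := ⊥
  continuous_snd.comp (homeo l H).continuous

instance [IsTopologicalGroup H] : IsTopologicalGroup (Cables l H) := by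
  let _ : TopologicalSpace (Perm (Fin l)) := ⊥
  have _ : DiscreteTopology (Perm (Fin l)) := ⟨rfl⟩
  have hr : Continuous fun c : Cables l H => c.right := continuous_right l H
  refine { continuous_mul := ?_, continuous_inv := ?_ }
  · refine (homeo l H).comp_continuous_iff.1 (Continuous.prodMk (continuous_pi fun j => ?_) ?_)
    · exact ((continuous_apply j).comp ((continuous_left l H).comp continuous_fst)).mul
        (continuous_apply_perm ((continuous_left l H).comp continuous_snd)
          (hr.comp continuous_fst) j)
    · exact (continuous_of_discreteTopology (f := fun q : Perm (Fin l) × Perm (Fin l) => q.1 * q.2)).comp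
        (Continuous.prodMk (hr.comp continuous_fst) (hr.comp continuous_snd))
  · refine (homeo l H).comp_continuous_iff.1 (Continuous.prodMk (continuous_pi fun j => ?_) ?_)
    · exact (continuous_apply_perm (continuous_left l H)
        ((continuous_of_discreteTopology (f := fun q : Perm (Fin l) => q⁻¹)).comp hr) j).inv
    · exact (continuous_of_discreteTopology (f := fun q : Perm (Fin l) => q⁻¹)).comp hr

instance [CompactSpace H] : CompactSpace (Cables l H) :=
  letI : TopologicalSpace (Perm (Fin l)) := ⊥
  (homeo l H).symm.compactSpace

instance [TotallyDisconnectedSpace H] : TotallyDisconnectedSpace (Cables l H) :=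
  letI : TopologicalSpace (Perm (Fin l)) := ⊥
  haveI : DiscreteTopology (Perm (Fin l)) := ⟨rfl⟩
  (homeo l H).symm.totallyDisconnectedSpace

end Cables

end Cabling

/-- The profinite braid group. -/
abbrev ProfBraid (n : ℕ) : ProfiniteGrp.{0} := Hat (Braid n)

namespace ProfBraid

/-- The natural projection from the profinite braid group to the symmetric group. -/
noncomputable def toPerm (l : ℕ) : ProfBraid l →* Equiv.Perm (Fin l) :=
  (Hat.extend (P := ProfiniteGrp.ofFiniteGrp (FiniteGrp.of (Equiv.Perm (Fin l))))
    (Braid.toPerm l)).toMonoidHom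

/-- The continuous extension of `Braid.cable` to the profinite braid group. -/
noncomputable def cable (l n : ℕ) (hn : 1 ≤ n) :
    ProfBraid l →ₜ* Cables l (ProfBraid (l + n - 1)) :=
  Hat.extend (P := ProfiniteGrp.of (Cables l (ProfBraid (l + n - 1))))
    ((Cables.map l (Hat.ofGroup _)).comp (Braid.cable l n hn))

/-- `ev^{j, e_n}(b)`: the string of `b` which ends at the position `j` on the top is replaced by `n`
parallel strings. -/
noncomputable def evTop (l n : ℕ) (hn : 1 ≤ n) (j : Fin l) (b : ProfBraid l) :
    ProfBraid (l + n - 1) :=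
  (cable l n hn b).left j

/-- `ev_{k, e_n}(b)`: the string of `b` which starts from the position `k` on the bottom (and hence
ends at the position `b(k)` on the top) is replaced by `n` parallel strings. -/
noncomputable def evBot (l n : ℕ) (hn : 1 ≤ n) (k : Fin l) (b : ProfBraid l) :
    ProfBraid (l + n - 1) :=
  evTop l n hn (toPerm l b k) b

end ProfBraid

/-! ### The profinite Grothendieck–Teichmüller group and its action on profinite braids -/

/-- The profinite completion of the free group of rank two. -/
abbrev ProfF2 : ProfiniteGrp.{0} := Hat (FreeGroup (Fin 2))

namespace ProfF2

/-- The first free generator. -/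
def X : ProfF2 := Hat.ofGroup _ (FreeGroup.of 0)

/-- The second free generator. -/
def Y : ProfF2 := Hat.ofGroup _ (FreeGroup.of 1)

/-- `f(α, β)`: the image of `f` under the continuous homomorphism with `x ↦ α` and `y ↦ β`. -/
noncomputable def eval {P : ProfiniteGrp.{0}} (f : ProfF2) (α β : P) : P :=
  Hat.extend (P := P) (FreeGroup.lift ![α, β]) f

/-- For consecutive blocks of `p`, `q`, `r` strings, the first one starting with the string number
`a`, the element `f(x_{a⋯a+p-1, a+p⋯a+p+q-1}, x_{a+p⋯a+p+q-1, a+p+q⋯a+p+q+r-1})` of the profinite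
braid group with `N` strings; it is understood to be trivial if the first block is empty. -/
noncomputable def block (f : ProfF2) (N a p q r : ℕ) : ProfBraid N :=
  if p = 0 then 1 else
    eval (P := ProfBraid N) f (Hat.ofGroup _ (Braid.xBlock N a p (a + p) q))
      (Hat.ofGroup _ (Braid.xBlock N (a + p) q (a + p + q) r))

/-- `f_{[m₁],[n],[m₂]} = f_{1⋯m₁, m₁+1⋯m₁+n-1, m₁+n} ⋯ f_{1⋯m₁, m₁+1 m₁+2, m₁+3} f_{1⋯m₁, m₁+1, m₁+2}`
in the profinite braid group with `N = m₁ + n + m₂` strings. -/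
noncomputable def bracket (f : ProfF2) (N m₁ n : ℕ) : ProfBraid N :=
  ((List.range (n - 1)).map fun t => block f N 1 m₁ (t + 1) 1).reverse.prod

end ProfF2

open ProfF2 in
/-- The elements `σ = (λ, f)` of the profinite Grothendieck–Teichmüller group: automorphisms of the
free profinite group of rank two with `x ↦ x ^ λ` and `y ↦ f⁻¹ y ^ λ f`, subject to the 2-cycle,
hexagon and pentagon relations. -/
structure GTHat where
  toAut : ProfF2 ≃ₜ* ProfF2
  lam : ZHatˣ
  f : ProfF2
  map_X : toAut X = Hat.zpow X lam
  map_Y : toAut Y = f⁻¹ * Hat.zpow Y lam * f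
  two_cycle : eval f X Y * eval f Y X = 1
  hexagon : ∃ m : ZHat, (lam : ZHat) = 2 * m + 1 ∧
    eval f (X * Y)⁻¹ X * Hat.zpow (X * Y)⁻¹ m * eval f Y (X * Y)⁻¹ * Hat.zpow Y m *
      eval f X Y * Hat.zpow X m = 1
  pentagon : block f 4 1 1 1 2 * block f 4 1 2 1 1 =
    block f 4 2 1 1 1 * block f 4 1 1 2 1 * block f 4 1 1 1 1

namespace GTHat

/-- `φ` maps `σ_i` to `f_{1⋯i-1, i, i+1}⁻¹ σ_i ^ λ f_{1⋯i-1, i, i+1}` for all `i`. -/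
def IsAction (σ : GTHat) (n : ℕ) (φ : ProfBraid n →ₜ* ProfBraid n) : Prop :=
  ∀ i : ℕ, 1 ≤ i → i < n →
    φ (Hat.ofGroup _ (Braid.sigma n i)) =
      (ProfF2.block σ.f n 1 (i - 1) 1 1)⁻¹ * Hat.zpow (Hat.ofGroup _ (Braid.sigma n i)) σ.lam *
        ProfF2.block σ.f n 1 (i - 1) 1 1

open Classical in
/-- The action of `σ = (λ, f)` on the profinite braid group: the unique continuous homomorphism with
`σ_i ↦ f_{1⋯i-1, i, i+1}⁻¹ σ_i ^ λ f_{1⋯i-1, i, i+1}`. -/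
noncomputable def act (σ : GTHat) (n : ℕ) : ProfBraid n →ₜ* ProfBraid n :=
  if h : ∃ φ, σ.IsAction n φ then h.choose else ContinuousMonoidHom.id _

end GTHat

/-! ### Homomorphisms from profinite completions, evaluation and profinite powers -/

namespace Hat

variable {G : Type} [Group G]

/-! All cablings of a braid `b` by `n` strings are the components of one continuous homomorphism,
`ProfBraid.cable`, with values in the semidirect product of the `l`-th power of $\widehat B_{l+n-1}$
with $\mathfrak S_l$. There the proposition becomes a single identity, `map_act_cable`: applying
$\sigma$ to every component of the cabling of $b$ gives the cabling of $\sigma(b)$, conjugated by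
the base element whose $j$-th component is the bracket $f_{[j],[n],[l-1-j]}$. Both sides are
continuous homomorphisms in $b$, so only the Artin generators matter (`act_cableSigma`). The
$\mathfrak S_l$-component shows that $\sigma$ preserves permutations, which makes the two formulas
of the proposition equivalent.

For a generator, write $\sigma_i^\lambda=(\sigma_i^2)^m\sigma_i$ with $m=(\lambda-1)/2$, where
$\sigma_i^2=x_{i,i+1}$. Cabling is well behaved on the block elements: $x_{A,C}$ is the full twist
of $A\cup C$ divided by those of $A$ and of $C$ (`xBlock_eq`), and cabling a full twist gives the
full twist of the enlarged set of strings divided by that of the parallel strings (`cable_twist`).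
Hence cabling $f_{A,C,D}$ merely enlarges a block (`cable_block`), and cabling the pentagon in
$\widehat B_4$ at each of its strings gives the pentagon for arbitrary nonempty blocks
(`pentagon_block`).

If the cabled string avoids the crossing, the bracket commutes with $\sigma(\sigma_i)$. Otherwise
the cabled generator is a product of $n$ consecutive generators, treated by induction on $n$
(`act_upHat`, `act_downHat`): the pentagon makes the image of the new generator local (`actGen_eq`),
a hexagon merges it with the crossings already treated (`up_hexagon`, `down_hexagon`), and another
pentagon (`pentagon_succ`) restores the brackets.

The hexagon is used for three elements whose product is central rather than trivial
(`hexagon_of_central`). The same tools prove that the action exists: `actGen_eq` reduces the braid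
relation between the images of neighbouring generators to two elements with $aba=bab$, and these are
handled by `braid_of_hexagon`. -/

lemma extend_ofGroup {P : ProfiniteGrp.{0}} (φ : G →* P) (g : G) :
    extend φ (ofGroup G g) = φ g :=
  CategoryTheory.ConcreteCategory.congr_hom
    (ProfiniteGrp.ProfiniteCompletion.lift_eta (G := GrpCat.of G) (GrpCat.ofHom φ)) g

lemma denseRange_ofGroup : DenseRange (ofGroup G) :=
  ProfiniteGrp.ProfiniteCompletion.denseRange (GrpCat.of G)

lemma eq_of_eqOn_ofGroup {X : Type*} [TopologicalSpace X] [T2Space X] {φ ψ : Hat G → X}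
    (hφ : Continuous φ) (hψ : Continuous ψ) (h : ∀ g, φ (ofGroup G g) = ψ (ofGroup G g))
    (a : Hat G) : φ a = ψ a :=
  congrFun (denseRange_ofGroup.equalizer hφ hψ (funext h)) a

/-- The exponents `c mod L!`, which converge to `c`. -/
def approx (c : ZHat) (L : ℕ) : ℕ := (c.1 (Nat.toPNat L.factorial L.factorial_pos)).val

lemma pow_approx {N : FiniteIndexNormalSubgroup G} (q : G ⧸ N.toSubgroup) (c : ZHat) {L : ℕ}
    (hL : (quotCard N : ℕ) ≤ L) : q ^ approx c L = q ^ (c.1 (quotCard N)).val := by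
  have h : (quotCard N : ℕ) ∣ (Nat.toPNat L.factorial L.factorial_pos : ℕ+) :=
    Nat.dvd_factorial (quotCard N).pos hL
  have hc := c.2 _ (Nat.toPNat L.factorial L.factorial_pos) h
  rw [← hc, ZMod.castHom_apply, ZMod.cast_eq_val, ZMod.val_natCast]
  exact (pow_mod_natCard q _).symm

/-- The exponents are ordinary integers that do not depend on `g`, so identities between ordinary
powers pass to profinite powers by continuity. -/
lemma tendsto_pow_approx (g : Hat G) (c : ZHat) :
    Filter.Tendsto (fun L => g ^ approx c L) Filter.atTop (nhds (zpow g c)) := by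
  refine Topology.IsInducing.subtypeVal.tendsto_nhds_iff.2 (tendsto_pi_nhds.2 fun N => ?_)
  refine tendsto_const_nhds.congr' ?_
  filter_upwards [Filter.eventually_ge_atTop (quotCard N : ℕ)] with L hL
  exact (pow_approx (N := N) (g.1 N) c hL).symm

lemma map_zpow {H : Type} [Group H] (φ : Hat G →ₜ* Hat H) (g : Hat G) (c : ZHat) :
    φ (zpow g c) = zpow (φ g) c := by
  refine tendsto_nhds_unique ((φ.continuous_toFun.tendsto _).comp (tendsto_pow_approx g c)) ?_
  refine (tendsto_pow_approx (φ g) c).congr fun L => ?_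
  exact (map_pow φ g _).symm

lemma mul_zpow {g h : Hat G} (hgh : Commute g h) (c : ZHat) :
    zpow (g * h) c = zpow g c * zpow h c := by
  refine tendsto_nhds_unique (tendsto_pow_approx _ c) ?_
  refine ((tendsto_pow_approx g c).mul (tendsto_pow_approx h c)).congr fun L => ?_
  exact (hgh.mul_pow _).symm

lemma one_zpow (c : ZHat) : zpow (1 : Hat G) c = 1 := by
  refine tendsto_nhds_unique (tendsto_pow_approx _ c) ?_
  simp

lemma inv_zpow (g : Hat G) (c : ZHat) : zpow g⁻¹ c = (zpow g c)⁻¹ := by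
  rw [eq_inv_iff_mul_eq_one, ← mul_zpow (Commute.refl g).inv_left, inv_mul_cancel, one_zpow]

lemma semiconj_zpow {a g h : Hat G} (H : SemiconjBy a g h) (c : ZHat) :
    SemiconjBy a (zpow g c) (zpow h c) := by
  refine tendsto_nhds_unique ((tendsto_pow_approx g c).const_mul a) ?_
  refine ((tendsto_pow_approx h c).mul_const a).congr fun L => ?_
  exact (H.pow_right _).eq.symm

lemma commute_zpow {a g : Hat G} (H : Commute a g) (c : ZHat) : Commute a (zpow g c) :=
  semiconj_zpow H c

/-- Used with $c=\lambda$ to split the power of a crossing into a power of a pure braid and one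
crossing. In each finite quotient the exponents agree modulo the order of the quotient. -/
lemma zpow_two_mul_add_one (g : Hat G) {c m : ZHat} (h : c = 2 * m + 1) :
    zpow g c = zpow (g ^ 2) m * g := by
  refine Subtype.ext (funext fun N => ?_)
  change (g.1 N : G ⧸ N.toSubgroup) ^ (c.1 (quotCard N)).val =
    ((g.1 N : G ⧸ N.toSubgroup) ^ 2) ^ (m.1 (quotCard N)).val * (g.1 N : G ⧸ N.toSubgroup)
  generalize (g.1 N : G ⧸ N.toSubgroup) = q
  rw [← pow_mul, ← pow_succ, ← pow_mod_natCard, ← pow_mod_natCard q (2 * _ + 1)]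
  congr 1
  have h' : c.1 (quotCard N) = 2 * m.1 (quotCard N) + 1 := by rw [h]; rfl
  have h2 : (((c.1 (quotCard N)).val : ℕ) : ZMod (quotCard N)) =
      ((2 * (m.1 (quotCard N)).val + 1 : ℕ) : ZMod (quotCard N)) := by
    push_cast
    rw [ZMod.natCast_zmod_val, ZMod.natCast_zmod_val, h']
  exact (ZMod.natCast_eq_natCast_iff' _ _ _).1 h2

end Hat

/-! ### Evaluation of elements of the free profinite group -/

namespace ProfF2

variable {P Q : ProfiniteGrp.{0}}

lemma eval_ofGroup (w : FreeGroup (Fin 2)) (α β : P) :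
    eval (Hat.ofGroup _ w) α β = FreeGroup.lift ![α, β] w :=
  Hat.extend_ofGroup _ _

@[simp] lemma eval_X (α β : P) : eval X α β = α := by
  rw [X, eval_ofGroup]; simp

@[simp] lemma eval_Y (α β : P) : eval Y α β = β := by
  rw [Y, eval_ofGroup]; simp

@[simp] lemma eval_mul (f g : ProfF2) (α β : P) : eval (f * g) α β = eval f α β * eval g α β :=
  map_mul (Hat.extend (FreeGroup.lift ![α, β])) f g

@[simp] lemma eval_inv (f : ProfF2) (α β : P) : eval f⁻¹ α β = (eval f α β)⁻¹ :=
  map_inv (Hat.extend (FreeGroup.lift ![α, β])) f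

@[simp] lemma eval_one (α β : P) : eval 1 α β = 1 :=
  map_one (Hat.extend (FreeGroup.lift ![α, β]))

lemma continuous_eval (α β : P) : Continuous fun f => eval f α β :=
  (Hat.extend (FreeGroup.lift ![α, β])).continuous_toFun

/-- A continuous homomorphism on `F₂` is determined by the images of the generators. -/
lemma hom_eval {M : Type*} [Group M] [TopologicalSpace M] [T2Space M] (φ ψ : ProfF2 →* M)
    (hφ : Continuous φ) (hψ : Continuous ψ) (hX : φ X = ψ X) (hY : φ Y = ψ Y) (f : ProfF2) :
    φ f = ψ f := by
  refine Hat.eq_of_eqOn_ofGroup hφ hψ (fun w => ?_) f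
  refine DFunLike.congr_fun (?_ : φ.comp (Hat.ofGroup _) = ψ.comp (Hat.ofGroup _)) w
  refine FreeGroup.ext_hom _ _ fun i => ?_
  fin_cases i
  · exact hX
  · exact hY

/-- Evaluation at a pair of elements, as a homomorphism. -/
noncomputable def evalHom (α β : P) : ProfF2 →* P := (Hat.extend (FreeGroup.lift ![α, β])).toMonoidHom

lemma map_eval (φ : P →ₜ* Q) (f : ProfF2) (α β : P) : φ (eval f α β) = eval f (φ α) (φ β) :=
  hom_eval (φ.toMonoidHom.comp (evalHom α β)) (evalHom (φ α) (φ β))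
    (φ.continuous_toFun.comp (continuous_eval α β)) (continuous_eval _ _)
    ((congrArg φ (eval_X α β)).trans (eval_X (φ α) (φ β)).symm)
    ((congrArg φ (eval_Y α β)).trans (eval_Y (φ α) (φ β)).symm) f

lemma map_eval_zpow {G : Type} [Group G] (f : ProfF2) (α β : Hat G) (c : ZHat) :
    eval (P := Hat G) (Hat.zpow f c) α β = Hat.zpow (eval (P := Hat G) f α β) c :=
  Hat.map_zpow (Hat.extend (FreeGroup.lift ![α, β])) f c

lemma semiconj_eval {a α β α' β' : P} (f : ProfF2) (hα : SemiconjBy a α α')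
    (hβ : SemiconjBy a β β') : SemiconjBy a (eval f α β) (eval f α' β') := by
  have h := hom_eval ((MulAut.conj a).toMonoidHom.comp (evalHom α β)) (evalHom α' β')
    ((continuous_const.mul (continuous_eval α β)).mul continuous_const) (continuous_eval _ _)
    ((congrArg (MulAut.conj a) (eval_X α β)).trans
      ((mul_inv_eq_iff_eq_mul.2 hα).trans (eval_X α' β').symm))
    ((congrArg (MulAut.conj a) (eval_Y α β)).trans
      ((mul_inv_eq_iff_eq_mul.2 hβ).trans (eval_Y α' β').symm)) f
  exact mul_inv_eq_iff_eq_mul.1 h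

lemma commute_eval {a α β : P} (f : ProfF2) (hα : Commute a α) (hβ : Commute a β) :
    Commute a (eval f α β) :=
  semiconj_eval f hα hβ

/-- The evaluations at $(\alpha,\beta)$ and at $(c,d)$ have commuting images on words, so their
product is again multiplicative there; density does the rest. -/
lemma eval_mul_mul {α β c d : P} (f : ProfF2) (h1 : Commute c α) (h2 : Commute c β)
    (h3 : Commute d α) (h4 : Commute d β) :
    eval f (α * c) (β * d) = eval f α β * eval f c d := by
  refine Hat.eq_of_eqOn_ofGroup (φ := fun f => eval f (α * c) (β * d))
    (ψ := fun f => eval f α β * eval f c d) (continuous_eval _ _)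
    ((continuous_eval _ _).mul (continuous_eval _ _)) (fun w => ?_) f
  have hc : ∀ w, Commute (eval (Hat.ofGroup _ w) c d) α ∧ Commute (eval (Hat.ofGroup _ w) c d) β :=
    fun w => ⟨(commute_eval _ h1.symm h3.symm).symm, (commute_eval _ h2.symm h4.symm).symm⟩
  have hw : ∀ v w, Commute (eval (Hat.ofGroup _ v) c d) (eval (Hat.ofGroup _ w) α β) :=
    fun v w => commute_eval _ (hc v).1 (hc v).2
  simp only [eval_ofGroup] at hw ⊢
  induction w using FreeGroup.induction_on with
  | C1 => simp
  | of i => fin_cases i <;> simp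
  | inv_of i _ =>
    have := hw (FreeGroup.of i) (FreeGroup.of i)
    fin_cases i <;> simp at this ⊢
    · exact this.inv_inv.eq
    · exact this.inv_inv.eq
  | mul v w hv hw' =>
    rw [map_mul, hv, hw', map_mul, map_mul]
    have := (hw v w).eq
    simp only [mul_assoc]
    rw [← mul_assoc (FreeGroup.lift ![c, d] v), this, mul_assoc]

lemma eval_mul_eq_one {f : ProfF2} (hf : eval f X Y * eval f Y X = 1) (α β : P) :
    eval f α β * eval f β α = 1 := by
  have h := congrArg (fun g => eval g α β) hf
  simpa [map_eval (P := ProfF2) (Hat.extend (FreeGroup.lift ![α, β])), eval_mul,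
    show ∀ u v : ProfF2, eval (eval f u v) α β = eval f (eval u α β) (eval v α β) from
      fun u v => map_eval (P := ProfF2) (Hat.extend (FreeGroup.lift ![α, β])) f u v] using h

end ProfF2

/-! ### The hexagon relation with a central product -/

namespace GTHat

open ProfF2

variable (σ : GTHat) {P : ProfiniteGrp.{0}} {G : Type} [Group G]

lemma eval_swap (α β : P) : eval σ.f α β = (eval σ.f β α)⁻¹ :=
  eq_inv_of_mul_eq_one_left (eval_mul_eq_one σ.two_cycle α β)

/-- The element `m = (λ - 1) / 2`. -/
noncomputable def m : ZHat := σ.hexagon.choose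

lemma lam_eq : (σ.lam : ZHat) = 2 * σ.m + 1 := σ.hexagon.choose_spec.1

lemma zpow_lam (g : Hat G) : Hat.zpow g σ.lam = Hat.zpow (g ^ 2) σ.m * g :=
  Hat.zpow_two_mul_add_one g σ.lam_eq

/-- The first hexagon relation for elements with central product. -/
lemma hexagon_of_central {x y w c : Hat G} (hc : x * y * w = c) (hx : Commute c x)
    (hy : Commute c y) :
    eval (P := Hat G) σ.f w x * Hat.zpow w σ.m * eval (P := Hat G) σ.f y w * Hat.zpow y σ.m *
      eval (P := Hat G) σ.f x y * Hat.zpow x σ.m = Hat.zpow c σ.m := by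
  have hw : Commute c w := by
    have : w = (x * y)⁻¹ * c := by rw [← hc]; group
    rw [this]
    exact ((hx.mul_right hy).inv_right).mul_right (Commute.refl c)
  have hz : (x * y)⁻¹ = w * c⁻¹ := by rw [← hc]; group
  have he : ∀ u v : ProfF2, eval (P := Hat G) (eval σ.f u v) x y =
      eval (P := Hat G) σ.f (eval (P := Hat G) u x y) (eval (P := Hat G) v x y) :=
    fun u v => map_eval (P := ProfF2) (Q := Hat G) (Hat.extend (FreeGroup.lift ![x, y])) σ.f u v
  have h := congrArg (fun g => eval (P := Hat G) g x y) σ.hexagon.choose_spec.2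
  simp only [eval_mul, eval_inv, eval_X, eval_Y, eval_one, map_eval_zpow, he] at h
  rw [hz] at h
  -- The element $z$ is now $wc^{-1}$, so its occurrences split into a part with $w$ and a part with
  -- $c$. The factors $f(c^{-1},1)$ and $f(1,c^{-1})$ are inverse to each other by the 2-cycle
  -- relation and cancel without being computed.
  have h1 : eval (P := Hat G) σ.f (w * c⁻¹) x =
      eval (P := Hat G) σ.f w x * eval (P := Hat G) σ.f c⁻¹ 1 := by
    simpa using eval_mul_mul (P := Hat G) (d := 1) σ.f hw.inv_left hx.inv_left
      (Commute.one_left _) (Commute.one_left _)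
  have h2 : eval (P := Hat G) σ.f y (w * c⁻¹) =
      eval (P := Hat G) σ.f y w * eval (P := Hat G) σ.f 1 c⁻¹ := by
    simpa using eval_mul_mul (P := Hat G) (c := 1) σ.f (Commute.one_left _) (Commute.one_left _)
       hy.inv_left hw.inv_left
  have h3 : Hat.zpow (w * c⁻¹) σ.m = Hat.zpow w σ.m * (Hat.zpow c σ.m)⁻¹ := by
    rw [Hat.mul_zpow hw.symm.inv_right, Hat.inv_zpow]
  have h4 := σ.eval_swap (P := Hat G) 1 c⁻¹
  change _ * Hat.zpow (w * c⁻¹) σ.m * _ * _ * _ * _ = 1 at h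
  rw [h1, h2, h3, h4] at h
  set e := eval (P := Hat G) σ.f c⁻¹ 1
  have hce : ∀ g, Commute c g → Commute e g := fun g hg =>
    (commute_eval (P := Hat G) σ.f hg.symm.inv_right (Commute.one_right g)).symm
  have hcz : ∀ g, Commute c g → Commute (Hat.zpow c σ.m) g := fun g hg =>
    (Hat.commute_zpow hg.symm σ.m).symm
  have A : ∀ g, Commute c g → Commute (Hat.zpow c σ.m)⁻¹ g := fun g hg => (hcz g hg).inv_left
  have B : ∀ g, Commute c g → Commute e⁻¹ g := fun g hg => (hce g hg).inv_left
  have k1 := Hat.commute_zpow hw σ.m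
  have k2 := Hat.commute_zpow hy σ.m
  have k3 := Hat.commute_zpow hx σ.m
  have k4 := commute_eval (P := Hat G) σ.f hy hw
  have k5 := commute_eval (P := Hat G) σ.f hx hy
  have k6 := commute_eval (P := Hat G) σ.f hw hx
  have cc : Commute (Hat.zpow c σ.m)⁻¹ e :=
    A _ (commute_eval (P := Hat G) σ.f (Commute.refl c).inv_right (Commute.one_right c))
  change _ * e * (Hat.zpow w _ * _) * (_ * e⁻¹) * Hat.zpow y σ.m * _ * Hat.zpow x σ.m = 1 at h
  rw [← inv_inv (Hat.zpow c σ.m)]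
  refine eq_inv_of_mul_eq_one_right ?_
  generalize (Hat.zpow c σ.m)⁻¹ = C at *
  have q1 := (hce _ k1).eq
  have q2 := (hce _ k4).eq
  have q3 := (A _ k4).eq
  have q4 := (A _ k1).eq
  have q5 := (A _ k6).eq
  generalize eval (P := Hat G) σ.f w x = fwx at *
  generalize eval (P := Hat G) σ.f y w = fyw at *
  generalize Hat.zpow w σ.m = zw at *
  have key : C * fwx * zw * fyw = fwx * e * zw * C * fyw * e⁻¹ := by
    calc C * fwx * zw * fyw = fwx * C * zw * fyw := by rw [q5]
      _ = fwx * (C * zw) * fyw := by group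
      _ = fwx * zw * C * fyw := by rw [q4]; group
      _ = fwx * zw * (e * C) * e⁻¹ * fyw := by rw [← cc.eq]; group
      _ = fwx * (e * zw) * C * (e⁻¹ * fyw) := by rw [q1]; group
      _ = fwx * e * zw * C * fyw * e⁻¹ := by rw [(B _ k4).eq]; group
  simp only [← mul_assoc] at h ⊢
  rw [key, h]

end GTHat

/-! ### Full twists in braid groups -/

namespace Braid

variable {n : ℕ}

lemma up_succ' (n a m : ℕ) : up n a (m + 1) = sigma n a * up n (a + 1) m := by
  simp only [up, List.range_succ_eq_map, List.map_cons, List.prod_cons, List.map_map, add_zero]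
  congr 3
  funext t
  simp [add_assoc, add_comm 1]

lemma down_succ' (n a m : ℕ) : down n a (m + 1) = down n (a + 1) m * sigma n a := by
  simp only [down, List.range_succ_eq_map, List.map_cons, List.map_map, add_zero,
    List.reverse_cons, List.prod_append, List.prod_singleton]
  congr 4
  funext t
  simp [add_assoc, add_comm 1]

/-- Only the factors $\sigma_j\sigma_{j+1}$ interact, through the braid relation; the factors before
them commute with $\sigma_{j+1}$ and those after them with $\sigma_j$. -/
lemma up_semiconj {a m j : ℕ} (ha : 1 ≤ a) (hn : a + m ≤ n) (h1 : a ≤ j) (h2 : j + 1 < a + m) :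
    SemiconjBy (up n a m) (sigma n j) (sigma n (j + 1)) := by
  induction m with
  | zero => omega
  | succ m ih =>
    rw [up_succ]
    rcases lt_or_eq_of_le (show j + 1 ≤ a + m by omega) with h | h
    · exact (ih (by omega) h).mul_left (sigma_comm h).symm
    · obtain ⟨m, rfl⟩ : ∃ k, m = k + 1 := ⟨m - 1, by omega⟩
      have e : a + m = j := by omega
      rw [up_succ, e, ← h]
      have := (up_comm_of_lt (n := n) (a := a) (m := m) (j := j + 1) (by omega)).eq
      have hb := sigma_braid (n := n) (i := j) (by omega) (by omega)
      calc _ = up n a m * (sigma n j * sigma n (j + 1) * sigma n j) := by group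
        _ = _ := by rw [hb]; simp only [← mul_assoc]; rw [this]

lemma down_semiconj {a m j : ℕ} (ha : 1 ≤ a) (hn : a + m ≤ n) (h1 : a ≤ j)
    (h2 : j + 1 < a + m) : SemiconjBy (down n a m) (sigma n (j + 1)) (sigma n j) := by
  induction m with
  | zero => omega
  | succ m ih =>
    rw [down_succ]
    rcases lt_or_eq_of_le (show j + 1 ≤ a + m by omega) with h | h
    · exact SemiconjBy.mul_left (sigma_comm h).symm (ih (by omega) h)
    · obtain ⟨m, rfl⟩ : ∃ k, m = k + 1 := ⟨m - 1, by omega⟩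
      have e : a + m = j := by omega
      rw [down_succ, e, ← h]
      have := (down_comm_of_lt (n := n) (a := a) (m := m) (j := j + 1) (by omega)).eq
      have hb := sigma_braid (n := n) (i := j) (by omega) (by omega)
      calc _ = sigma n (j + 1) * sigma n j * (down n a m * sigma n (j + 1)) := by group
        _ = (sigma n (j + 1) * sigma n j * sigma n (j + 1)) * down n a m := by rw [this]; group
        _ = _ := by rw [← hb]; group

/-- The pure braid in which the string number `a + p` goes around the `p` strings to its left. -/
def loop (n a p : ℕ) : Braid n := down n a p * up n a p

/-- The full twist of the `p` strings starting with the string number `a`. -/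
def twist (n a : ℕ) : ℕ → Braid n
  | 0 => 1
  | p + 1 => twist n a p * loop n a p

@[simp] lemma twist_zero (n a : ℕ) : twist n a 0 = 1 := rfl

lemma twist_succ (n a p : ℕ) : twist n a (p + 1) = twist n a p * loop n a p := rfl

@[simp] lemma loop_zero (n a : ℕ) : loop n a 0 = 1 := by simp [loop]

@[simp] lemma twist_one (n a : ℕ) : twist n a 1 = 1 := by simp [twist_succ]

lemma loop_succ (n a p : ℕ) :
    loop n a (p + 1) = sigma n (a + p) * loop n a p * sigma n (a + p) := by
  simp only [loop, up_succ, down_succ, mul_assoc]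

lemma loop_add (n a p q : ℕ) :
    loop n a (p + q) = down n (a + p) q * loop n a p * up n (a + p) q := by
  induction q with
  | zero => simp
  | succ q ih =>
    rw [← add_assoc, loop_succ, ih, down_succ, up_succ, add_assoc]
    simp only [mul_assoc]

section Semiconj

variable {g : Braid n} {b m d : ℕ}

lemma semiconj_up (h : ∀ j, b ≤ j → j < b + m → SemiconjBy g (sigma n j) (sigma n (j + d))) :
    SemiconjBy g (up n b m) (up n (b + d) m) := by
  induction m with
  | zero => simp
  | succ m ih =>
    rw [up_succ, up_succ, add_right_comm]
    exact (ih fun j h1 h2 => h j h1 (by omega)).mul_right (h _ (by omega) (by omega))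

lemma semiconj_down (h : ∀ j, b ≤ j → j < b + m → SemiconjBy g (sigma n j) (sigma n (j + d))) :
    SemiconjBy g (down n b m) (down n (b + d) m) := by
  induction m with
  | zero => simp
  | succ m ih =>
    rw [down_succ, down_succ, add_right_comm]
    exact (h _ (by omega) (by omega)).mul_right (ih fun j h1 h2 => h j h1 (by omega))

lemma semiconj_loop (h : ∀ j, b ≤ j → j < b + m → SemiconjBy g (sigma n j) (sigma n (j + d))) :
    SemiconjBy g (loop n b m) (loop n (b + d) m) :=
  (semiconj_down h).mul_right (semiconj_up h)

lemma semiconj_twist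
    (h : ∀ j, b ≤ j → j + 1 < b + m → SemiconjBy g (sigma n j) (sigma n (j + d))) :
    SemiconjBy g (twist n b m) (twist n (b + d) m) := by
  induction m with
  | zero => simp
  | succ m ih =>
    exact (ih fun j h1 h2 => h j h1 (by omega)).mul_right
      (semiconj_loop fun j h1 h2 => h j h1 (by omega))

lemma commute_up (h : ∀ j, b ≤ j → j < b + m → Commute g (sigma n j)) : Commute g (up n b m) :=
  semiconj_up (d := 0) h

lemma commute_down (h : ∀ j, b ≤ j → j < b + m → Commute g (sigma n j)) :
    Commute g (down n b m) :=
  semiconj_down (d := 0) h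

lemma commute_loop (h : ∀ j, b ≤ j → j < b + m → Commute g (sigma n j)) :
    Commute g (loop n b m) :=
  semiconj_loop (d := 0) h

lemma commute_twist (h : ∀ j, b ≤ j → j + 1 < b + m → Commute g (sigma n j)) :
    Commute g (twist n b m) :=
  semiconj_twist (d := 0) h

end Semiconj

/-- `up` raises the index by one and `down` lowers it again. -/
lemma loop_commute_sigma {a p j : ℕ} (ha : 1 ≤ a) (hn : a + p ≤ n) (h1 : a ≤ j)
    (h2 : j + 1 < a + p) : Commute (loop n a p) (sigma n j) :=
  SemiconjBy.mul_left (down_semiconj ha hn h1 h2) (up_semiconj ha hn h1 h2)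

lemma sigma_commute_twist_of_far {a p j : ℕ} (h : j + 1 < a ∨ a + p ≤ j) :
    Commute (sigma n j) (twist n a p) :=
  commute_twist fun i h1 h2 => by
    rcases h with h | h
    · exact sigma_comm (by omega)
    · exact (sigma_comm (by omega)).symm

/-- Centrality of the full twist among its own strings. Only the last generator $\sigma_j$ is new in
the induction; there the twist ends in $L\cdot\sigma_jL\sigma_j$ with $L$ the shorter loop, and $L$
commutes with $\sigma_jL\sigma_j$. -/
lemma twist_commute_sigma {a p j : ℕ} (ha : 1 ≤ a) (hn : a + p ≤ n + 1) (h1 : a ≤ j)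
    (h2 : j + 1 < a + p) : Commute (twist n a p) (sigma n j) := by
  induction p with
  | zero => omega
  | succ p ih =>
    rcases lt_or_eq_of_le (show j + 1 ≤ a + p by omega) with h | h
    · rw [twist_succ]
      exact (ih (by omega) h).mul_left (loop_commute_sigma ha (by omega) h1 h)
    · obtain ⟨q, rfl⟩ : ∃ k, p = k + 1 := ⟨p - 1, by omega⟩
      have e : a + q = j := by omega
      rw [twist_succ, twist_succ, mul_assoc]
      refine Commute.mul_left (commute_twist fun i _ _ => (sigma_comm (by omega)).symm).symm ?_
      have hc : Commute (loop n a (q + 1)) (loop n a q) :=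
        commute_loop fun i h1 h2 => loop_commute_sigma ha (by omega) h1 (by omega)
      have h3 := loop_succ n a q
      rw [e] at h3
      have hc' := hc.eq
      rw [h3] at hc' ⊢
      change _ * _ = _ * _
      calc _ = loop n a q * (sigma n j * loop n a q * sigma n j) * sigma n j := by
            simp only [mul_assoc]
        _ = sigma n j * loop n a q * sigma n j * loop n a q * sigma n j := by rw [hc']
        _ = _ := by simp only [mul_assoc]

lemma loop_eq_x_mul (n a p : ℕ) : loop n a (p + 1) = x n a (a + p + 1) * loop n (a + 1) p := by
  rw [loop, loop, x, up_succ', down_succ', show a + p + 1 - 1 - a = p by omega, pow_two]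
  group

/-- Makes products of `x n a j` over `j` telescope. By `down_down`, the conjugate of $\sigma_{a+m}$
by `down n a m` is the conjugate of $\sigma_a$ whose square is `x`. -/
lemma up_mul_down_succ {a m : ℕ} (ha : 1 ≤ a) (hn : a + m < n) :
    up n a (m + 1) * down n a (m + 1) = up n a m * down n a m * x n a (a + m + 1) := by
  have h := down_down (n := n) ha hn
  have h' : (down n a m)⁻¹ * sigma n (a + m) * down n a m =
      down n (a + 1) m * sigma n a * (down n (a + 1) m)⁻¹ := by
    rw [eq_mul_inv_iff_mul_eq]
    calc _ = (down n a m)⁻¹ * (sigma n (a + m) * (down n a m * down n (a + 1) m)) := by group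
      _ = _ := by rw [← h]; group
  rw [x, show a + m + 1 - 1 - a = m by omega, up_succ, down_succ]
  calc _ = up n a m * down n a m * ((down n a m)⁻¹ * sigma n (a + m) * down n a m) ^ 2 := by
        rw [pow_two]; group
    _ = _ := by rw [h', pow_two, pow_two]; group

/-- The definition of `twist` adds a last string, whereas the lexicographic order in `xBlock`
requires splitting off the first. Adding a string multiplies both descriptions by the same element
`x`, by `loop_eq_x_mul` and `up_mul_down_succ`. -/
lemma twist_succ' {a p : ℕ} (ha : 1 ≤ a) (hn : a + p ≤ n) :
    twist n a (p + 1) = up n a p * down n a p * twist n (a + 1) p := by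
  induction p with
  | zero => simp
  | succ p ih =>
    have h1 : Commute (loop n a (p + 1)) (twist n (a + 1) p) :=
      commute_twist fun j h1 h2 => loop_commute_sigma ha hn (by omega) (by omega)
    have h2 : Commute (loop n (a + 1) p) (twist n (a + 1) p) :=
      commute_twist fun j h1 h2 => loop_commute_sigma (by omega) (by omega) h1 h2
    rw [twist_succ, ih (by omega), up_mul_down_succ ha (by omega), twist_succ, mul_assoc, ← h1.eq,
      loop_eq_x_mul, ← h2.eq]
    simp only [mul_assoc]

lemma prod_x_row {a p q : ℕ} (ha : 1 ≤ a) (hn : a + p + q ≤ n) :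
    ((List.range q).map fun t => x n a (a + p + 1 + t)).prod =
      (up n a p * down n a p)⁻¹ * (up n a (p + q) * down n a (p + q)) := by
  induction q with
  | zero => simp
  | succ q ih =>
    rw [List.range_succ, List.map_append, List.prod_append, ih (by omega), ← add_assoc p,
      up_mul_down_succ ha (by omega)]
    simp only [List.map_cons, List.map_nil, List.prod_singleton]
    rw [show a + p + 1 + q = a + (p + q) + 1 by omega]
    group

/-- Replaces an ordered product by full twists, whose centrality makes commutation and cabling
accessible. Each row of the product telescopes (`prod_x_row`), and the induction removes the first
string of the left block. -/
lemma xBlock_eq {a p q b : ℕ} (ha : 1 ≤ a) (hn : a + p + q ≤ n + 1) (hb : b = a + p) :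
    xBlock n a p b q = twist n a (p + q) * (twist n a p)⁻¹ * (twist n b q)⁻¹ := by
  subst hb
  induction p generalizing a with
  | zero => simp [xBlock]
  | succ p ih =>
    have e : xBlock n a (p + 1) (a + (p + 1)) q =
        ((List.range q).map fun t => x n a (a + p + 1 + t)).prod *
          xBlock n (a + 1) p (a + 1 + p) q := by
      simp only [xBlock, List.range_succ_eq_map, List.map_cons, List.prod_cons, List.map_map,
        add_zero]
      congr 3
      funext s
      simp only [Function.comp, Nat.succ_eq_add_one, add_assoc, add_comm 1]
    have e1 := twist_succ' (n := n) (p := p) ha (by omega)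
    have e2 := twist_succ' (n := n) (p := p + q) ha (by omega)
    rw [e, prod_x_row ha (by omega), ih (by omega) (by omega), add_right_comm p, e2, e1,
      add_right_comm a 1, ← add_assoc]
    set u := up n a (p + q) * down n a (p + q)
    set v := up n a p * down n a p
    -- The braid `v` uses only strings of the full twist on the left, which is central there.
    have c1 : Commute (u * twist n (a + 1) (p + q)) v := by
      rw [← e2]
      exact (commute_up fun j h1 h2 => twist_commute_sigma ha (by omega) h1 (by omega)).mul_right
        (commute_down fun j h1 h2 => twist_commute_sigma ha (by omega) h1 (by omega))
    have c2 : Commute v (twist n (a + 1) p) := by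
      have h : Commute (v * twist n (a + 1) p) (twist n (a + 1) p) := by
        rw [← e1]
        exact commute_twist fun j h1 h2 => twist_commute_sigma ha (by omega) (by omega) (by omega)
      simpa using h.mul_left (Commute.refl (twist n (a + 1) p)).inv_left
    rw [mul_inv_rev v, ← c2.inv_inv.eq]
    calc _ = v⁻¹ * (u * twist n (a + 1) (p + q)) * (twist n (a + 1) p)⁻¹ *
          (twist n (a + p + 1) q)⁻¹ := by group
      _ = _ := by rw [← c1.inv_right.eq]; simp only [mul_assoc]

end Braid

/-! ### Cabling of full twists -/

namespace Braid

lemma twist_mul_up {n a m : ℕ} (ha : 1 ≤ a) (hn : a + m ≤ n) :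
    SemiconjBy (up n a m) (twist n a m) (twist n (a + 1) m) :=
  semiconj_twist fun _ h1 h2 => up_semiconj ha hn h1 h2

lemma twist_mul_down {n a m : ℕ} (ha : 1 ≤ a) (hn : a + m ≤ n) :
    SemiconjBy (down n a m) (twist n (a + 1) m) (twist n a m) := by
  have h : SemiconjBy (down n a m)⁻¹ (twist n a m) (twist n (a + 1) m) :=
    semiconj_twist fun _ h1 h2 => (down_semiconj ha hn h1 h2).inv_symm_left
  simpa using h.inv_symm_left

/-- The inductive step of `cable_loop` when the cabled string is the one that goes around. The
missing `loop N a p` is taken from the inverse twist, and `loop_add` then completes the full twist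
of $p+n+1$ strings. -/
lemma up_mul_twist_mul_down {N a p n : ℕ} (ha : 1 ≤ a) (hn : a + p + n ≤ N) :
    up N (a + p) n * (twist N a (p + n) * (twist N a p)⁻¹ * (twist N (a + p) n)⁻¹) *
        down N (a + p) n =
      twist N a (p + 1 + n) * (twist N a (p + 1))⁻¹ * (twist N (a + (p + 1)) n)⁻¹ := by
  have h1 := (twist_mul_down (n := N) (a := a + p) (m := n) (by omega) hn).inv_right.eq
  have h2 : Commute (twist N a p) (down N (a + p) n) :=
    commute_down fun j _ _ => (sigma_commute_twist_of_far (by omega)).symm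
  have h3 : Commute (twist N a (p + n + 1)) (up N (a + p) n) :=
    commute_up fun j h1 h2 => twist_commute_sigma ha (by omega) (by omega) (by omega)
  have e : (twist N a p)⁻¹ = loop N a p * (twist N a (p + 1))⁻¹ := by
    rw [twist_succ]; group
  rw [show p + 1 + n = p + n + 1 by omega, ← add_assoc a p 1]
  have h5 : twist N a (p + n) * down N (a + p) n * loop N a p * up N (a + p) n =
      twist N a (p + n + 1) := by
    rw [twist_succ, loop_add]; group
  calc _ = up N (a + p) n * twist N a (p + n) * (twist N a p)⁻¹ *
        ((twist N (a + p) n)⁻¹ * down N (a + p) n) := by group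
    _ = up N (a + p) n * twist N a (p + n) * ((twist N a p)⁻¹ * down N (a + p) n) *
        (twist N (a + p + 1) n)⁻¹ := by rw [← h1]; group
    _ = up N (a + p) n * (twist N a (p + n) * down N (a + p) n * loop N a p * up N (a + p) n) *
        (up N (a + p) n)⁻¹ * (twist N a (p + 1))⁻¹ * (twist N (a + p + 1) n)⁻¹ := by
      rw [h2.inv_left.eq, e]; group
    _ = _ := by rw [h5, ← h3.eq]; group

variable (l n : ℕ)

/-- The cabling of `loop l a p` at the string number `k`. -/
def cableLoop (a p k : ℕ) : Braid (l + n - 1) :=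
  if k < a then loop (l + n - 1) (a + n - 1) p
  else if k < a + p then loop (l + n - 1) a (p + n - 1)
  else if k = a + p then twist (l + n - 1) a (p + n) * (twist (l + n - 1) a p)⁻¹ *
    (twist (l + n - 1) (a + p) n)⁻¹
  else loop (l + n - 1) a p

/-- The cabling of `twist l a p` at the string number `k`. -/
def cableTwist (a p k : ℕ) : Braid (l + n - 1) :=
  if k < a then twist (l + n - 1) (a + n - 1) p
  else if k < a + p then twist (l + n - 1) a (p + n - 1) * (twist (l + n - 1) k n)⁻¹
  else twist (l + n - 1) a p

variable {l n}

lemma cable_sigma (hn : 1 ≤ n) {i : ℕ} (h : 1 ≤ i ∧ i < l) :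
    cable l n hn (sigma l i) = cableGen l n ⟨i, h⟩ := by
  rw [sigma, dif_pos h]
  exact PresentedGroup.toGroup.of _

/-- In `loop_succ` the outer generators exchange two positions, so component `j` for the longer loop
comes from component `swapAt j` for the shorter one; the cases are the positions of `j` relative to
the crossing. -/
lemma cable_loop (hn : 1 ≤ n) {a p : ℕ} (ha : 1 ≤ a) (hp : a + p ≤ l) :
    cable l n hn (loop l a p) = SemidirectProduct.inl fun j : Fin l => cableLoop l n a p (j + 1) := by
  induction p with
  | zero =>
    rw [loop_zero, map_one, eq_comm, ← map_one SemidirectProduct.inl]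
    congr 1
    funext j
    simp only [cableLoop]
    split_ifs <;> simp
    omega
  | succ p ih =>
    have hi : 1 ≤ a + p ∧ a + p < l := by omega
    rw [loop_succ, map_mul, map_mul, ih (by omega), cable_sigma hn hi]
    refine SemidirectProduct.ext (funext fun j => ?_) ?_
    swap
    · simp [cableGen, swapAt]
    change cableSigma l n ⟨a + p, hi⟩ j * cableLoop l n a p (((swapAt l ⟨a + p, hi⟩)⁻¹ j : Fin l) + 1) *
      cableSigma l n ⟨a + p, hi⟩ (((swapAt l ⟨a + p, hi⟩) * 1)⁻¹ j) = cableLoop l n a (p + 1) (j + 1)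
    rw [mul_one, show (swapAt l ⟨a + p, hi⟩)⁻¹ = swapAt l ⟨a + p, hi⟩ from Equiv.swap_inv _ _]
    generalize hs : swapAt l ⟨a + p, hi⟩ j = s
    rcases lt_trichotomy ((j : ℕ) + 1) (a + p) with h | h | h
    · have hs' : (s : ℕ) = j := hs ▸ swapAt_val_of_lt h
      rw [cableSigma_of_lt h, cableSigma_of_lt (by simp only; omega), hs']
      simp only [cableLoop]
      split_ifs <;> try omega
      · rw [loop_succ]; congr 2 <;> congr 1 <;> omega
      · rw [show p + 1 + n - 1 = (p + n - 1) + 1 by omega, loop_succ]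
        congr 2 <;> congr 1 <;> omega
    · have hs' : (s : ℕ) = a + p := hs ▸ swapAt_val_left h
      rw [cableSigma_left h, cableSigma_right hs']
      simp only [cableLoop]
      split_ifs <;> try omega
      rw [show p + 1 + n - 1 = p + n by omega, loop_add]
    · rcases eq_or_lt_of_le (show a + p ≤ j by omega) with h' | h'
      · have hs' : (s : ℕ) + 1 = a + p := hs ▸ swapAt_val_right h'.symm
        rw [cableSigma_right h'.symm, cableSigma_left hs', hs']
        simp only [cableLoop]
        split_ifs <;> try omega
        exact up_mul_twist_mul_down ha (by omega)
      · have hs' : (s : ℕ) = j := hs ▸ swapAt_val_of_gt h'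
        rw [cableSigma_of_gt h', cableSigma_of_gt (by simp only; omega), hs']
        simp only [cableLoop]
        split_ifs <;> try omega
        rw [loop_succ]

/-- Parallel strings do not twist around each other, so their own full twist must be divided out of
the larger one. -/
lemma cable_twist (hn : 1 ≤ n) {a p : ℕ} (ha : 1 ≤ a) (hp : a + p ≤ l + 1) :
    cable l n hn (twist l a p) = SemidirectProduct.inl fun j : Fin l => cableTwist l n a p (j + 1) := by
  induction p with
  | zero =>
    rw [twist_zero, map_one, eq_comm, ← map_one SemidirectProduct.inl]
    congr 1
    funext j
    simp only [cableTwist]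
    split_ifs <;> first | omega | simp
  | succ p ih =>
    rw [twist_succ, map_mul, ih (by omega), cable_loop hn ha (by omega), ← map_mul]
    congr 1
    funext j
    have hj := j.2
    simp only [Pi.mul_apply, cableTwist, cableLoop]
    split_ifs <;> try omega
    · rfl
    · have : Commute (loop (l + n - 1) a (p + n - 1)) (twist (l + n - 1) (j + 1) n) :=
        commute_twist fun i _ _ => loop_commute_sigma ha (by omega) (by omega) (by omega)
      rw [mul_assoc, ← this.inv_right.eq, ← mul_assoc, ← twist_succ,
        show p + 1 + n - 1 = p + n - 1 + 1 by omega]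
    · have e : (j : ℕ) + 1 = a + p := by omega
      have : Commute (twist (l + n - 1) a p) (twist (l + n - 1) a (p + n)) :=
        (commute_twist fun i _ _ => twist_commute_sigma ha (by omega) (by omega) (by omega)).symm
      rw [e, show p + 1 + n - 1 = p + n by omega, ← mul_assoc, ← mul_assoc, this.eq]
      group
    · rw [twist_succ]

end Braid

/-! ### Cabling of blocks and the pentagon relation for blocks -/

/-- The first string of a block starting with the string number `a`, after the string number `k` has
been replaced by `n` strings. -/
def startCable (n k a : ℕ) : ℕ := if k < a then a + n - 1 else a

/-- The number of strings in the block `a, …, a + p - 1` after the string number `k` has been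
replaced by `n` strings. -/
def sizeCable (n k a p : ℕ) : ℕ := if a ≤ k ∧ k < a + p then p + n - 1 else p

lemma startCable_add {n : ℕ} (hn : 1 ≤ n) (k a p : ℕ) :
    startCable n k (a + p) = startCable n k a + sizeCable n k a p := by
  simp only [startCable, sizeCable]
  split_ifs <;> omega

/-- By `xBlock_eq` this is a statement on full twists. The correction by the twist of the parallel
strings occurs in the twist of the union and in the twist of the block being enlarged, and cancels
in the quotient. -/
lemma Braid.cable_xBlock {l n : ℕ} (hn : 1 ≤ n) {a p q b : ℕ} (ha : 1 ≤ a)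
    (hl : a + p + q ≤ l + 1) (hb : b = a + p) :
    cable l n hn (xBlock l a p b q) = SemidirectProduct.inl fun j : Fin l =>
      xBlock (l + n - 1) (startCable n (j + 1) a) (sizeCable n (j + 1) a p)
        (startCable n (j + 1) b) (sizeCable n (j + 1) b q) := by
  subst hb
  rw [xBlock_eq ha hl rfl, map_mul, map_mul, map_inv, map_inv, cable_twist hn ha (by omega),
    cable_twist hn ha (by omega), cable_twist hn (by omega) (by omega), ← map_inv, ← map_inv,
    ← map_mul, ← map_mul]
  congr 1
  funext j
  have hj := j.2
  rw [xBlock_eq _ _ (startCable_add hn _ _ _)]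
  · simp only [Pi.mul_apply, Pi.inv_apply, cableTwist, startCable, sizeCable]
    split_ifs <;> try omega
    · congr 3
    · rw [show a + p + n - 1 = a + (p + n - 1) by omega,
        show p + n - 1 + q = p + q + n - 1 by omega]
      group
    · have : Commute (twist (l + n - 1) a p) (twist (l + n - 1) (j + 1) n) :=
        commute_twist fun i _ _ => (sigma_commute_twist_of_far (by omega)).symm
      rw [mul_inv_rev, inv_inv, mul_assoc _ _ (twist _ a p)⁻¹, ← this.inv_inv.eq,
        show p + (q + n - 1) = p + q + n - 1 by omega]
      group
    · rfl
  · simp only [startCable]; split_ifs <;> omega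
  · simp only [startCable, sizeCable]; split_ifs <;> omega

namespace Cables

variable {l : ℕ} {H : Type} [Group H] [TopologicalSpace H]

lemma continuous_inl :
    Continuous (SemidirectProduct.inl : (Fin l → H) →* Cables l H) :=
  letI : TopologicalSpace (Equiv.Perm (Fin l)) := ⊥
  continuous_induced_rng.2 (continuous_id.prodMk continuous_const)

instance [T2Space H] : T2Space (Cables l H) :=
  letI : TopologicalSpace (Equiv.Perm (Fin l)) := ⊥
  haveI : DiscreteTopology (Equiv.Perm (Fin l)) := ⟨rfl⟩
  (homeo l H).symm.t2Space

end Cables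

namespace ProfBraid

/-- The image in the profinite braid group of the block `xBlock` of two adjacent blocks. -/
noncomputable def xB (N a p q : ℕ) : ProfBraid N := Hat.ofGroup _ (Braid.xBlock N a p (a + p) q)

lemma cable_ofGroup {l n : ℕ} (hn : 1 ≤ n) (b : Braid l) :
    cable l n hn (Hat.ofGroup _ b) =
      Cables.map l (Hat.ofGroup (Braid (l + n - 1))) (Braid.cable l n hn b) :=
  Hat.extend_ofGroup (P := ProfiniteGrp.of (Cables l (ProfBraid (l + n - 1)))) _ b

lemma cable_xB {l n : ℕ} (hn : 1 ≤ n) {a p q : ℕ} (ha : 1 ≤ a) (hl : a + p + q ≤ l + 1) :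
    cable l n hn (xB l a p q) = SemidirectProduct.inl fun j : Fin l =>
      xB (l + n - 1) (startCable n (j + 1) a) (sizeCable n (j + 1) a p)
        (sizeCable n (j + 1) (a + p) q) := by
  rw [xB, cable_ofGroup, Braid.cable_xBlock hn ha hl rfl]
  simp only [startCable_add hn, xB]
  exact SemidirectProduct.ext rfl rfl

lemma cable_eval {l n : ℕ} (hn : 1 ≤ n) (f : ProfF2) {α β : ProfBraid l}
    {u v : Fin l → ProfBraid (l + n - 1)} (hα : cable l n hn α = SemidirectProduct.inl u)
    (hβ : cable l n hn β = SemidirectProduct.inl v) :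
    cable l n hn (ProfF2.eval f α β) =
      SemidirectProduct.inl fun j => ProfF2.eval (P := ProfBraid (l + n - 1)) f (u j) (v j) := by
  refine ProfF2.hom_eval ((cable l n hn).toMonoidHom.comp (ProfF2.evalHom α β))
    ((SemidirectProduct.inl : _ →* Cables l (ProfBraid (l + n - 1))).comp
      (MonoidHom.pi fun j => ProfF2.evalHom (P := ProfBraid (l + n - 1)) (u j) (v j)))
    ((cable l n hn).continuous_toFun.comp (ProfF2.continuous_eval α β))
    (Cables.continuous_inl.comp (continuous_pi fun j =>
      ProfF2.continuous_eval (P := ProfBraid (l + n - 1)) _ _)) ?_ ?_ f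
  · refine (congrArg (cable l n hn) (ProfF2.eval_X α β)).trans (hα.trans ?_)
    exact congrArg SemidirectProduct.inl
      (funext fun j => (ProfF2.eval_X (P := ProfBraid (l + n - 1)) (u j) (v j)).symm)
  · refine (congrArg (cable l n hn) (ProfF2.eval_Y α β)).trans (hβ.trans ?_)
    exact congrArg SemidirectProduct.inl
      (funext fun j => (ProfF2.eval_Y (P := ProfBraid (l + n - 1)) (u j) (v j)).symm)

end ProfBraid

namespace ProfF2

open ProfBraid

lemma block_zero (f : ProfF2) (N a q r : ℕ) : block f N a 0 q r = 1 := if_pos rfl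

lemma block_of_pos (f : ProfF2) (N a : ℕ) {p : ℕ} (q r : ℕ) (hp : p ≠ 0) :
    block f N a p q r = eval (P := ProfBraid N) f (xB N a p q) (xB N (a + p) q r) := if_neg hp

/-- An empty first block stays empty after cabling, so the convention for it is respected. -/
lemma cable_block (f : ProfF2) {l n : ℕ} (hn : 1 ≤ n) {a p q r : ℕ} (ha : 1 ≤ a)
    (hl : a + p + q + r ≤ l + 1) :
    cable l n hn (block f l a p q r) = SemidirectProduct.inl fun j : Fin l =>
      block f (l + n - 1) (startCable n (j + 1) a) (sizeCable n (j + 1) a p)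
        (sizeCable n (j + 1) (a + p) q) (sizeCable n (j + 1) (a + p + q) r) := by
  rcases eq_or_ne p 0 with rfl | hp
  · rw [block_zero, map_one, eq_comm, ← map_one SemidirectProduct.inl]
    congr 1
    funext j
    rw [sizeCable, if_neg (by omega), block_zero]; rfl
  · rw [block_of_pos _ _ _ _ _ hp, cable_eval hn f (cable_xB hn ha (by omega))
      (cable_xB hn (by omega) hl)]
    congr 1
    funext j
    rw [block_of_pos, startCable_add hn]
    rw [sizeCable]; split_ifs <;> omega

/-- The pentagon relation for four successive blocks. -/
def Pentagon (f : ProfF2) (N p q r s : ℕ) : Prop :=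
  block f N 1 p q (r + s) * block f N 1 (p + q) r s =
    block f N (1 + p) q r s * block f N 1 p (q + r) s * block f N 1 p q r

lemma Pentagon.cable {f : ProfF2} {l n p q r s : ℕ} (h : Pentagon f l p q r s)
    (hl : p + q + r + s ≤ l) (hn : 1 ≤ n) (j : Fin l) :
    Pentagon f (l + n - 1) (sizeCable n (j + 1) 1 p) (sizeCable n (j + 1) (1 + p) q)
      (sizeCable n (j + 1) (1 + p + q) r) (sizeCable n (j + 1) (1 + p + q + r) s) := by
  unfold Pentagon at h
  have h1 := congrArg (fun b => (ProfBraid.cable l n hn b).left j) h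
  have e1 : sizeCable n (j + 1) (1 + p + q) (r + s) =
      sizeCable n (j + 1) (1 + p + q) r + sizeCable n (j + 1) (1 + p + q + r) s := by
    simp only [sizeCable]; split_ifs <;> omega
  have e2 : sizeCable n (j + 1) 1 (p + q) =
      sizeCable n (j + 1) 1 p + sizeCable n (j + 1) (1 + p) q := by
    simp only [sizeCable]; split_ifs <;> omega
  have e3 : sizeCable n (j + 1) (1 + p) (q + r) =
      sizeCable n (j + 1) (1 + p) q + sizeCable n (j + 1) (1 + p + q) r := by
    simp only [sizeCable]; split_ifs <;> omega
  have e4 : startCable n (j + 1) 1 = 1 := by simp [startCable]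
  beta_reduce at h1
  rw [map_mul, map_mul, map_mul] at h1
  simp only [cable_block f (l := l) hn (a := 1) (p := p) (q := q) (r := r + s) le_rfl (by omega),
    cable_block f (l := l) hn (a := 1) (p := p + q) (q := r) (r := s) le_rfl (by omega),
    cable_block f (l := l) hn (a := 1 + p) (p := q) (q := r) (r := s) (by omega) (by omega),
    cable_block f (l := l) hn (a := 1) (p := p) (q := q + r) (r := s) le_rfl (by omega),
    cable_block f (l := l) hn (a := 1) (p := p) (q := q) (r := r) le_rfl (by omega), ← map_mul,
    SemidirectProduct.left_inl, Pi.mul_apply, startCable_add hn, ← add_assoc, e1, e2, e3, e4] at h1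
  exact h1

end ProfF2

/-! ### Inclusions of braid groups and the pentagon relation -/

namespace Braid

lemma twist_mem {N : ℕ} {K : Subgroup (Braid N)} {a p : ℕ}
    (h : ∀ j, a ≤ j → j + 1 < a + p → sigma N j ∈ K) : twist N a p ∈ K := by
  have hu : ∀ m, m < p → up N a m ∈ K ∧ down N a m ∈ K := by
    intro m hm
    induction m with
    | zero => simp
    | succ m ih =>
      rw [up_succ, down_succ]
      have := h (a + m) (by omega) (by omega)
      exact ⟨K.mul_mem (ih (by omega)).1 this, K.mul_mem this (ih (by omega)).2⟩
  induction p with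
  | zero => simp
  | succ p ih =>
    exact K.mul_mem (ih (fun j h1 h2 => h j h1 (by omega)) fun m hm => hu m (by omega))
      (K.mul_mem (hu p (by omega)).2 (hu p (by omega)).1)

lemma xBlock_mem {N : ℕ} {K : Subgroup (Braid N)} {a p q b : ℕ} (ha : 1 ≤ a)
    (hn : a + p + q ≤ N + 1) (hb : b = a + p)
    (h : ∀ j, a ≤ j → j + 1 < a + p + q → sigma N j ∈ K) : xBlock N a p b q ∈ K := by
  rw [xBlock_eq ha hn hb]
  exact K.mul_mem (K.mul_mem (twist_mem fun j h1 h2 => h j h1 (by omega))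
    (K.inv_mem (twist_mem fun j h1 h2 => h j h1 (by omega))))
    (K.inv_mem (twist_mem fun j h1 h2 => h j (by omega) (by omega)))

/-- The inclusion of `B_M` into `B_N` for `M ≤ N`, on the first `M` strings. -/
def incl {M N : ℕ} (_ : M ≤ N) : Braid M →* Braid N :=
  PresentedGroup.toGroup (f := fun i : {i : ℕ // 1 ≤ i ∧ i < M} => sigma N i) (by
    rintro r (⟨i, j, h, rfl⟩ | ⟨i, j, h, rfl⟩)
    · have hi := i.2
      have hj := j.2
      simp only [map_mul, map_inv, FreeGroup.lift_apply_of, h]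
      exact mul_inv_eq_one.2 (sigma_braid (by omega) (by omega))
    · simp only [map_mul, map_inv, FreeGroup.lift_apply_of]
      exact mul_inv_eq_one.2 (sigma_comm h))

section

variable {M N : ℕ} (h : M ≤ N)

lemma incl_sigma {i : ℕ} (hi : i < M) : incl h (sigma M i) = sigma N i := by
  rcases Nat.eq_zero_or_pos i with rfl | h0
  · simp [sigma]
  · rw [sigma, dif_pos ⟨h0, hi⟩]
    exact PresentedGroup.toGroup.of _

lemma incl_up {a m : ℕ} (hm : a + m ≤ M) : incl h (up M a m) = up N a m := by
  induction m with
  | zero => simp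
  | succ m ih => rw [up_succ, map_mul, ih (by omega), incl_sigma h (by omega), up_succ]

lemma incl_down {a m : ℕ} (hm : a + m ≤ M) : incl h (down M a m) = down N a m := by
  induction m with
  | zero => simp
  | succ m ih => rw [down_succ, map_mul, ih (by omega), incl_sigma h (by omega), down_succ]

lemma incl_twist {a m : ℕ} (hm : a + m ≤ M + 1) : incl h (twist M a m) = twist N a m := by
  induction m with
  | zero => simp
  | succ m ih =>
    rw [twist_succ, map_mul, ih (by omega), loop, map_mul, incl_up h (by omega),
      incl_down h (by omega), twist_succ, loop]

lemma incl_xBlock {a p q b : ℕ} (ha : 1 ≤ a) (hn : a + p + q ≤ M + 1) (hb : b = a + p) :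
    incl h (xBlock M a p b q) = xBlock N a p b q := by
  rw [xBlock_eq ha hn hb, xBlock_eq ha (by omega) hb, map_mul, map_mul, map_inv, map_inv,
    incl_twist h (by omega), incl_twist h (by omega), incl_twist h (by omega)]

end

/-- A crossing inside one block, or away from both, commutes with each of the three full twists of
`xBlock_eq`, either by centrality or by distance. -/
lemma sigma_commute_xBlock {N a p q b j : ℕ} (ha : 1 ≤ a) (hn : a + p + q ≤ N + 1)
    (hb : b = a + p)
    (h : j + 1 < a ∨ (a ≤ j ∧ j + 1 < b) ∨ (b ≤ j ∧ j + 1 < b + q) ∨ b + q ≤ j) :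
    Commute (sigma N j) (xBlock N a p b q) := by
  have key : ∀ c r, 1 ≤ c → c + r ≤ N + 1 → (j + 1 < c ∨ (c ≤ j ∧ j + 1 < c + r) ∨ c + r ≤ j) →
      Commute (sigma N j) (twist N c r) := by
    rintro c r h1 h2 (h | h | h)
    · exact sigma_commute_twist_of_far (Or.inl h)
    · exact (twist_commute_sigma h1 h2 h.1 h.2).symm
    · exact sigma_commute_twist_of_far (Or.inr h)
  rw [xBlock_eq ha hn hb]
  exact ((key a (p + q) ha (by omega) (by omega)).mul_right
    (key a p ha (by omega) (by omega)).inv_right).mul_right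
    (key b q (by omega) (by omega) (by omega)).inv_right

end Braid

/-! ### Commutation with blocks in profinite braid groups -/

namespace ProfBraid

/-- The generator `σ_i` of the profinite braid group. -/
noncomputable def sigma (N i : ℕ) : ProfBraid N := Hat.ofGroup _ (Braid.sigma N i)

/-- The inclusion of profinite braid groups on the first strings. -/
noncomputable def incl {M N : ℕ} (h : M ≤ N) : ProfBraid M →ₜ* ProfBraid N :=
  Hat.extend (P := ProfBraid N) ((Hat.ofGroup _).comp (Braid.incl h))

lemma incl_xB {M N : ℕ} (h : M ≤ N) {a p q : ℕ} (ha : 1 ≤ a) (hn : a + p + q ≤ M + 1) :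
    incl h (xB M a p q) = xB N a p q :=
  (Hat.extend_ofGroup (P := ProfBraid N) _ _).trans
    (congrArg (Hat.ofGroup _) (Braid.incl_xBlock h ha hn rfl))

/-- Pulling the centralizer of `g` back to the discrete braid group lets `g` be any profinite braid,
not only the image of a braid. -/
lemma commute_xB {N a p q : ℕ} {g : ProfBraid N} (ha : 1 ≤ a) (hn : a + p + q ≤ N + 1)
    (h : ∀ j, a ≤ j → j + 1 < a + p + q → Commute g (sigma N j)) : Commute g (xB N a p q) := by
  have := Braid.xBlock_mem (K := (Subgroup.centralizer {g}).comap (Hat.ofGroup (Braid N))) ha hn rfl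
    fun j h1 h2 => Subgroup.mem_centralizer_singleton_iff.2 (h j h1 h2).symm.eq
  exact (show Commute _ _ from Subgroup.mem_centralizer_singleton_iff.1 this).symm

lemma sigma_commute_xB {N a p q j : ℕ} (ha : 1 ≤ a) (hn : a + p + q ≤ N + 1)
    (h : j + 1 < a ∨ (a ≤ j ∧ j + 1 < a + p) ∨ (a + p ≤ j ∧ j + 1 < a + p + q) ∨ a + p + q ≤ j) :
    Commute (sigma N j) (xB N a p q) :=
  (Braid.sigma_commute_xBlock ha hn rfl h).map (Hat.ofGroup _)

lemma xB_one_one (N i : ℕ) : xB N i 1 1 = sigma N i ^ 2 := by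
  rw [xB, sigma, ← map_pow]
  congr 1
  simp [Braid.xBlock, Braid.x]

lemma sigma_comm {N i j : ℕ} (h : i + 1 < j) : Commute (sigma N i) (sigma N j) :=
  (Braid.sigma_comm h).map _

lemma sigma_braid {N i : ℕ} (h1 : 1 ≤ i) (h2 : i + 1 < N) :
    sigma N i * sigma N (i + 1) * sigma N i = sigma N (i + 1) * sigma N i * sigma N (i + 1) := by
  simp only [sigma, ← map_mul]
  exact congrArg (Hat.ofGroup _) (Braid.sigma_braid h1 h2)

end ProfBraid

namespace ProfF2

open ProfBraid

variable (f : ProfF2)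

lemma incl_block {M N : ℕ} (h : M ≤ N) {a p q r : ℕ} (ha : 1 ≤ a) (hn : a + p + q + r ≤ M + 1) :
    incl h (block f M a p q r) = block f N a p q r := by
  rcases eq_or_ne p 0 with rfl | hp
  · rw [block_zero, block_zero, map_one]
  · rw [block_of_pos _ _ _ _ _ hp, block_of_pos _ _ _ _ _ hp, ← incl_xB h ha (by omega),
      ← incl_xB h (by omega) hn]
    exact map_eval (P := ProfBraid M) (Q := ProfBraid N) (incl h) f _ _

lemma commute_block {N a p q r : ℕ} {g : ProfBraid N} (ha : 1 ≤ a) (hn : a + p + q + r ≤ N + 1)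
    (h : ∀ j, a ≤ j → j + 1 < a + p + q + r → Commute g (sigma N j)) :
    Commute g (block f N a p q r) := by
  rcases eq_or_ne p 0 with rfl | hp
  · rw [block_zero]; exact Commute.one_right g
  · rw [block_of_pos _ _ _ _ _ hp]
    exact commute_eval (P := ProfBraid N) f
      (commute_xB ha (by omega) fun j h1 h2 => h j h1 (by omega))
      (commute_xB (by omega) hn fun j h1 h2 => h j (by omega) h2)

lemma sigma_commute_block {N a p q r j : ℕ} (ha : 1 ≤ a) (hn : a + p + q + r ≤ N + 1)
    (h : j + 1 < a ∨ (a ≤ j ∧ j + 1 < a + p) ∨ (a + p ≤ j ∧ j + 1 < a + p + q) ∨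
      (a + p + q ≤ j ∧ j + 1 < a + p + q + r) ∨ a + p + q + r ≤ j) :
    Commute (sigma N j) (block f N a p q r) := by
  rcases eq_or_ne p 0 with rfl | hp
  · rw [block_zero]; exact Commute.one_right _
  · rw [block_of_pos _ _ _ _ _ hp]
    exact commute_eval (P := ProfBraid N) f (sigma_commute_xB ha (by omega) (by omega))
      (sigma_commute_xB (by omega) hn (by omega))

end ProfF2

namespace GTHat

open ProfF2 ProfBraid

variable (σ : GTHat)

/-- Replacing the four strings of the defining pentagon successively by $p,q,r,s$ strings gives the
relation on $p+q+r+s$ strings, which is then included into $\widehat B_N$. Cabling needs positive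
sizes; for $p=0$ both sides reduce to the same block. -/
lemma pentagon_block {N p q r s : ℕ} (hq : 1 ≤ q) (hr : 1 ≤ r) (hs : 1 ≤ s)
    (hN : p + q + r + s ≤ N) : Pentagon σ.f N p q r s := by
  rcases Nat.eq_zero_or_pos p with rfl | hp
  · simp only [Pentagon, block_zero, one_mul, mul_one, zero_add, add_zero]
  have h0 : Pentagon σ.f 4 1 1 1 1 := σ.pentagon
  have h1 := h0.cable (by omega) hp ⟨0, by omega⟩
  rw [show sizeCable p (0 + 1) 1 1 = p by rw [sizeCable, if_pos] <;> omega,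
    show sizeCable p (0 + 1) (1 + 1) 1 = 1 by rw [sizeCable, if_neg]; omega,
    show sizeCable p (0 + 1) (1 + 1 + 1) 1 = 1 by rw [sizeCable, if_neg]; omega,
    show sizeCable p (0 + 1) (1 + 1 + 1 + 1) 1 = 1 by rw [sizeCable, if_neg]; omega] at h1
  have h2 := h1.cable (by omega) hq ⟨p, by omega⟩
  rw [show sizeCable q (p + 1) 1 p = p by rw [sizeCable, if_neg]; omega,
    show sizeCable q (p + 1) (1 + p) 1 = q by rw [sizeCable, if_pos] <;> omega,
    show sizeCable q (p + 1) (1 + p + 1) 1 = 1 by rw [sizeCable, if_neg]; omega,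
    show sizeCable q (p + 1) (1 + p + 1 + 1) 1 = 1 by rw [sizeCable, if_neg]; omega] at h2
  have h3 := h2.cable (by omega) hr ⟨p + q, by omega⟩
  rw [show sizeCable r (p + q + 1) 1 p = p by rw [sizeCable, if_neg]; omega,
    show sizeCable r (p + q + 1) (1 + p) q = q by rw [sizeCable, if_neg]; omega,
    show sizeCable r (p + q + 1) (1 + p + q) 1 = r by rw [sizeCable, if_pos] <;> omega,
    show sizeCable r (p + q + 1) (1 + p + q + 1) 1 = 1 by rw [sizeCable, if_neg]; omega] at h3
  have h4 := h3.cable (by omega) hs ⟨p + q + r, by omega⟩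
  rw [show sizeCable s (p + q + r + 1) 1 p = p by rw [sizeCable, if_neg]; omega,
    show sizeCable s (p + q + r + 1) (1 + p) q = q by rw [sizeCable, if_neg]; omega,
    show sizeCable s (p + q + r + 1) (1 + p + q) r = r by rw [sizeCable, if_neg]; omega,
    show sizeCable s (p + q + r + 1) (1 + p + q + r) 1 = s by
      rw [sizeCable, if_pos] <;> omega] at h4
  generalize hM : 4 + p - 1 + q - 1 + r - 1 + s - 1 = M at h4
  have hMN : M ≤ N := by omega
  unfold Pentagon at h4
  have h5 := congrArg (incl hMN) h4
  rw [map_mul, map_mul, map_mul] at h5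
  rwa [incl_block σ.f hMN le_rfl (by omega), incl_block σ.f hMN le_rfl (by omega),
    incl_block σ.f hMN (by omega) (by omega), incl_block σ.f hMN le_rfl (by omega),
    incl_block σ.f hMN le_rfl (by omega)] at h5

/-! ### The action on braid groups -/

/-- Write $A=a^\lambda$, $g=f(a^2,b^2)$ and $B=g^{-1}b^\lambda g$. Conjugation by $\Delta=aba$
exchanges $a$ and $b$, hence inverts $g$ by the 2-cycle relation, and $\Delta^2$ is central for
$a,b$. The hexagon gives $ABA=\Delta^{2m}g^{-1}\Delta$, with $\Delta^{2m}$ short for $(\Delta^2)^m$.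
-/
lemma braid_of_hexagon {G : Type} [Group G] {a b : Hat G} (hab : a * b * a = b * a * b) :
    Hat.zpow a σ.lam * ((eval (P := Hat G) σ.f (a ^ 2) (b ^ 2))⁻¹ * Hat.zpow b σ.lam *
        eval (P := Hat G) σ.f (a ^ 2) (b ^ 2)) * Hat.zpow a σ.lam =
      (eval (P := Hat G) σ.f (a ^ 2) (b ^ 2))⁻¹ * Hat.zpow b σ.lam *
        eval (P := Hat G) σ.f (a ^ 2) (b ^ 2) * Hat.zpow a σ.lam *
        ((eval (P := Hat G) σ.f (a ^ 2) (b ^ 2))⁻¹ * Hat.zpow b σ.lam *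
          eval (P := Hat G) σ.f (a ^ 2) (b ^ 2)) := by
  obtain ⟨Δ, hΔ⟩ : ∃ Δ, Δ = a * b * a := ⟨_, rfl⟩
  rw [← hΔ] at hab
  have da : SemiconjBy Δ a b := by
    change Δ * a = b * Δ
    rw [hab, ← mul_assoc, ← mul_assoc, mul_assoc (b * a) b a, mul_assoc b a, ← mul_assoc a b a, ← hΔ,
      hab]
    simp only [mul_assoc]
  have db : SemiconjBy Δ b a := by
    change Δ * b = a * Δ
    rw [hΔ, mul_assoc a b a, mul_assoc a, mul_assoc b, ← mul_assoc b a b, ← hab, hΔ]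
    simp only [mul_assoc]
  have c2 : a ^ 2 * b ^ 2 * (b⁻¹ * a ^ 2 * b) = Δ * Δ := by
    calc _ = a * (a * b * a) * a * b := by simp only [pow_two]; group
      _ = a * Δ * a * b := by rw [hΔ]
      _ = Δ * (b * a * b) := by rw [← db.eq]; simp only [mul_assoc]
      _ = _ := by rw [← hab]
  have ca : Commute (Δ * Δ) a := db.mul_left da
  have cb : Commute (Δ * Δ) b := da.mul_left db
  have H := σ.hexagon_of_central c2 (ca.pow_right 2) (cb.pow_right 2)
  have s1 : SemiconjBy a (b ^ 2) (b⁻¹ * a ^ 2 * b) := by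
    change a * b ^ 2 = b⁻¹ * a ^ 2 * b * a
    rw [eq_comm, mul_assoc, mul_assoc, inv_mul_eq_iff_eq_mul]
    calc _ = a * Δ := by simp only [hΔ, pow_two, mul_assoc]
      _ = Δ * b := db.eq.symm
      _ = b * a * b * b := by rw [hab]
      _ = _ := by simp only [pow_two, mul_assoc]
  have s2 : SemiconjBy b⁻¹ (a ^ 2) (b⁻¹ * a ^ 2 * b) := by
    change _ = _; group
  have e1 := (semiconj_eval (P := Hat G) σ.f s1 ((Commute.refl a).pow_right 2)).eq
  have e2 := (semiconj_eval (P := Hat G) σ.f ((Commute.refl b).inv_left.pow_right 2) s2).eq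
  have e3 := (Hat.semiconj_zpow s1 σ.m).eq
  have e4 := (semiconj_eval (P := Hat G) σ.f (da.pow_right 2) (db.pow_right 2)).eq
  have e5 := Hat.semiconj_zpow (da.pow_right 2) σ.m
  have e6 := Hat.semiconj_zpow (db.pow_right 2) σ.m
  have cg := commute_eval (P := Hat G) σ.f (ca.pow_right 2) (cb.pow_right 2)
  have cg' := (Hat.commute_zpow cg.symm σ.m).symm
  have cx := (Hat.commute_zpow (Hat.commute_zpow (ca.pow_right 2) σ.m).symm σ.m).symm
  have cy := (Hat.commute_zpow (Hat.commute_zpow (cb.pow_right 2) σ.m).symm σ.m).symm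
  have cb' := (Hat.commute_zpow cb.symm σ.m).symm
  have kb := (Hat.commute_zpow ((Commute.refl b).pow_right 2) σ.m).eq
  rw [σ.eval_swap (P := Hat G) (b ^ 2)] at e1 e2 e4
  rw [← mul_inv_eq_iff_eq_mul] at e1 e2 e3
  rw [← e1, ← e2, ← e3] at H
  rw [zpow_lam, zpow_lam]
  generalize eval (P := Hat G) σ.f (a ^ 2) (b ^ 2) = g at *
  generalize Hat.zpow (a ^ 2) σ.m = X at *
  generalize Hat.zpow (b ^ 2) σ.m = Y at *
  generalize Hat.zpow (Δ * Δ) σ.m = C at *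
  have hb : a⁻¹ * b⁻¹ = b * Δ⁻¹ := by rw [hab]; group
  have g1 : Δ⁻¹ * g⁻¹ = g * Δ⁻¹ := by
    rw [inv_mul_eq_iff_eq_mul, ← mul_assoc, e4]; group
  have g2 : Δ⁻¹ * g = g⁻¹ * Δ⁻¹ := by
    simpa using (congrArg Inv.inv e4).symm
  have d1 := da.inv_symm_left.eq
  have d2 := e5.inv_symm_left.eq
  have d3 := e6.inv_symm_left.eq
  -- The hexagon solved for $(\Delta^2)^m$: a factor $\Delta^{-1}$, created from $a^{-1}b^{-1}$, is
  -- pushed to the right end.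
  have hC : C = a * g⁻¹ * Y * b * g * X * a * g⁻¹ * Y * Δ⁻¹ := by
    calc C = a * g⁻¹ * Y * (a⁻¹ * b⁻¹) * g⁻¹ * (b * Y) * g * X := by rw [← H]; group
      _ = a * g⁻¹ * Y * b * (Δ⁻¹ * g⁻¹) * (Y * b) * g * X := by rw [hb, kb]; simp only [mul_assoc]
      _ = a * g⁻¹ * Y * b * g * (Δ⁻¹ * Y) * b * g * X := by rw [g1]; simp only [mul_assoc]
      _ = a * g⁻¹ * Y * b * g * X * (Δ⁻¹ * b) * g * X := by rw [d2]; simp only [mul_assoc]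
      _ = a * g⁻¹ * Y * b * g * X * a * (Δ⁻¹ * g) * X := by rw [d1]; simp only [mul_assoc]
      _ = a * g⁻¹ * Y * b * g * X * a * g⁻¹ * (Δ⁻¹ * X) := by rw [g2]; simp only [mul_assoc]
      _ = _ := by rw [d3]; simp only [mul_assoc]
  have key : X * a * (g⁻¹ * (Y * b) * g) * (X * a) = C * (g⁻¹ * Δ) := by
    calc _ = X * (a * g⁻¹ * Y * b * g * X * a * g⁻¹ * Y * Δ⁻¹) * (Δ * Y⁻¹ * g) := by group
      _ = X * C * (Δ * Y⁻¹ * g) := by rw [← hC]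
      _ = C * (X * Δ) * Y⁻¹ * g := by rw [← cx.eq]; simp only [mul_assoc]
      _ = C * (Δ * g) := by rw [← e6.eq]; group
      _ = _ := by rw [e4]
  have key' : g⁻¹ * (Y * b) * g * (C * (g⁻¹ * Δ)) = C * (g⁻¹ * Δ) * (X * a) := by
    have : Commute C (g⁻¹ * (Y * b) * g) := (cg'.inv_right.mul_right (cy.mul_right cb')).mul_right cg'
    rw [← mul_assoc, ← this.eq]
    calc _ = C * g⁻¹ * (Y * (b * Δ)) := by group
      _ = C * g⁻¹ * (Y * Δ * a) := by rw [← da.eq]; simp only [mul_assoc]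
      _ = _ := by rw [← e5.eq]; simp only [mul_assoc]
  -- After multiplying by $A$ on the right it suffices that $ABA\cdot A=B\cdot ABA$, since $B\cdot
  -- ABA=BAB\cdot A$.
  rw [← mul_left_inj (X * a)]
  calc _ = C * (g⁻¹ * Δ) * (X * a) := by rw [key]
    _ = _ := by rw [← key', ← key]; simp only [mul_assoc]

end GTHat

/-! ### Images of the generators and existence of the action -/

namespace GTHat

open ProfF2 ProfBraid

variable (σ : GTHat)

/-- The image of the generator `σ_i` under the action of `σ`. -/
noncomputable def actGen (N i : ℕ) : ProfBraid N :=
  (block σ.f N 1 (i - 1) 1 1)⁻¹ * Hat.zpow (sigma N i) σ.lam * block σ.f N 1 (i - 1) 1 1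

lemma sigma_commute_actGen {N t i : ℕ} (ht : 1 ≤ t) (hti : t + 1 < i) (hi : i < N) :
    Commute (sigma N t) (actGen σ N i) := by
  have h : Commute (sigma N t) (block σ.f N 1 (i - 1) 1 1) :=
    sigma_commute_block σ.f le_rfl (by omega) (by omega)
  exact (h.inv_right.mul_right (Hat.commute_zpow (ProfBraid.sigma_comm hti) _)).mul_right h

lemma actGen_comm {N i j : ℕ} (hi : 1 ≤ i) (hij : i + 1 < j) (hj : j < N) :
    Commute (actGen σ N i) (actGen σ N j) := by
  have h : Commute (actGen σ N j) (block σ.f N 1 (i - 1) 1 1) :=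
    commute_block σ.f le_rfl (by omega) fun t h1 h2 =>
      (sigma_commute_actGen σ h1 (by omega) hj).symm
  exact ((h.inv_right.mul_right (Hat.commute_zpow
    (sigma_commute_actGen σ hi hij hj).symm _)).mul_right h).symm

/-- The conjugate of a power of `σ_i`, written by means of the pentagon relation. -/
lemma actGen_eq {N p q : ℕ} (hq : 1 ≤ q) (hN : p + q + 2 ≤ N) :
    actGen σ N (p + q + 1) =
      (block σ.f N 1 p (q + 1) 1 * block σ.f N 1 p q 1)⁻¹ *
        ((block σ.f N (1 + p) q 1 1)⁻¹ * Hat.zpow (sigma N (p + q + 1)) σ.lam *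
          block σ.f N (1 + p) q 1 1) *
        (block σ.f N 1 p (q + 1) 1 * block σ.f N 1 p q 1) := by
  have h := σ.pentagon_block (N := N) (p := p) (q := q) (r := 1) (s := 1) hq le_rfl le_rfl
    (by omega)
  -- The last block here consists of exactly the two strings that cross, so this factor of the
  -- pentagon drops out of the conjugation.
  have hk : Commute (block σ.f N 1 p q (1 + 1)) (Hat.zpow (sigma N (p + q + 1)) σ.lam) :=
    Hat.commute_zpow (sigma_commute_block σ.f le_rfl (by omega) (by omega)).symm _
  unfold Pentagon at h
  rw [actGen, Nat.add_sub_cancel]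
  rw [← eq_inv_mul_iff_mul_eq] at h
  rw [h]
  generalize block σ.f N 1 p q (1 + 1) = k at *
  generalize Hat.zpow (sigma N (p + q + 1)) σ.lam = L at *
  have hk' : k * L * k⁻¹ = L := by rw [hk.eq]; group
  calc _ = (block σ.f N 1 p (q + 1) 1 * block σ.f N 1 p q 1)⁻¹ *
        ((block σ.f N (1 + p) q 1 1)⁻¹ * (k * L * k⁻¹) *
          block σ.f N (1 + p) q 1 1) *
        (block σ.f N 1 p (q + 1) 1 * block σ.f N 1 p q 1) := by group
    _ = _ := by rw [hk']

/-- Both images are conjugated by the same element `h * k`: for the second generator by `actGen_eq`,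
for the first because `h` commutes with the power of $\sigma_{p+1}$, whose two strings lie in one
block of `h`. What remains is `braid_of_hexagon`. -/
lemma actGen_braid {N i : ℕ} (hi : 1 ≤ i) (hN : i + 1 < N) :
    actGen σ N i * actGen σ N (i + 1) * actGen σ N i =
      actGen σ N (i + 1) * actGen σ N i * actGen σ N (i + 1) := by
  obtain ⟨p, rfl⟩ : ∃ p, i = p + 1 := ⟨i - 1, by omega⟩
  have hb := σ.braid_of_hexagon (G := Braid N) (ProfBraid.sigma_braid hi hN)
  have hh : Commute (block σ.f N 1 p (1 + 1) 1) (Hat.zpow (sigma N (p + 1)) σ.lam) :=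
    Hat.commute_zpow (sigma_commute_block σ.f le_rfl (by omega) (by omega)).symm _
  have hh' : (block σ.f N 1 p (1 + 1) 1)⁻¹ * Hat.zpow (sigma N (p + 1)) σ.lam *
      block σ.f N 1 p (1 + 1) 1 = Hat.zpow (sigma N (p + 1)) σ.lam := by
    rw [mul_assoc, ← hh.eq]; group
  rw [actGen_eq σ le_rfl (by omega), block_of_pos _ _ (1 + p) _ _ one_ne_zero, xB_one_one,
    xB_one_one, show 1 + p + 1 = p + 1 + 1 by omega, show 1 + p = p + 1 by omega, actGen,
    Nat.add_sub_cancel]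
  generalize block σ.f N 1 p (1 + 1) 1 = h at *
  generalize block σ.f N 1 p 1 1 = k at *
  generalize Hat.zpow (sigma N (p + 1)) σ.lam = A at *
  generalize (eval (P := ProfBraid N) σ.f (sigma N (p + 1) ^ 2) (sigma N (p + 1 + 1) ^ 2))⁻¹ *
    Hat.zpow (sigma N (p + 1 + 1)) σ.lam *
    eval (P := ProfBraid N) σ.f (sigma N (p + 1) ^ 2) (sigma N (p + 1 + 1) ^ 2) = B at *
  have hA : k⁻¹ * A * k = (h * k)⁻¹ * A * (h * k) := by
    calc _ = k⁻¹ * (h⁻¹ * A * h) * k := by rw [hh']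
      _ = _ := by group
  rw [hA]
  calc _ = (h * k)⁻¹ * (A * B * A) * (h * k) := by group
    _ = _ := by rw [hb]; group

lemma exists_isAction (N : ℕ) : ∃ φ, σ.IsAction N φ := by
  refine ⟨Hat.extend (P := ProfBraid N) (PresentedGroup.toGroup
    (f := fun i : {i : ℕ // 1 ≤ i ∧ i < N} => actGen σ N i) ?_), fun i h1 h2 => ?_⟩
  · rintro r (⟨i, j, h, rfl⟩ | ⟨i, j, h, rfl⟩)
    · have hi := i.2
      have hj := j.2
      simp only [map_mul, map_inv, FreeGroup.lift_apply_of, h]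
      exact mul_inv_eq_one.2 (σ.actGen_braid (by omega) (by omega))
    · simp only [map_mul, map_inv, FreeGroup.lift_apply_of]
      exact mul_inv_eq_one.2 (σ.actGen_comm i.2.1 h j.2.2).eq
  · rw [Hat.extend_ofGroup, Braid.sigma, dif_pos ⟨h1, h2⟩]
    refine (PresentedGroup.toGroup.of _).trans ?_
    simp only [actGen, sigma, Braid.sigma, dif_pos (And.intro h1 h2)]

/-- The default value in the definition of `act` is therefore never taken. -/
lemma isAction_act (N : ℕ) : σ.IsAction N (σ.act N) := by
  rw [act, dif_pos (σ.exists_isAction N)]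
  exact (σ.exists_isAction N).choose_spec

lemma act_sigma {N i : ℕ} (h1 : 1 ≤ i) (h2 : i < N) : σ.act N (sigma N i) = actGen σ N i :=
  σ.isAction_act N i h1 h2

/-! ### Hexagons for adding one string to a cable -/

section Hexagon

variable {G : Type} [Group G] {x s : Hat G}

/-- In the application $x$ is the string after a cable going around it, and $s$ is the next
crossing. The product $x\cdot s^2\cdot s^{-1}xs=x\cdot sxs$ commutes with $x$ and $s$, and its
$m$-th power splits because $x$ and $sxs$ commute; $x^m$ then cancels from the hexagon. -/
lemma hexagon_up (h : Commute x (s * x * s)) :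
    Hat.zpow x σ.m * ((eval (P := Hat G) σ.f x (s ^ 2))⁻¹ * Hat.zpow s σ.lam *
        eval (P := Hat G) σ.f x (s ^ 2)) =
      s * (eval (P := Hat G) σ.f (s⁻¹ * x * s) x)⁻¹ * Hat.zpow (s * x * s) σ.m := by
  have hc : x * s ^ 2 * (s⁻¹ * x * s) = x * (s * x * s) := by rw [pow_two]; group
  have hx : Commute (x * (s * x * s)) x := (Commute.refl x).mul_left h.symm
  have hs : Commute (x * (s * x * s)) s := by
    change x * (s * x * s) * s = s * (x * (s * x * s))
    calc _ = s * x * s * x * s := by rw [h.eq]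
      _ = _ := by simp only [mul_assoc]
  have H := σ.hexagon_of_central hc hx (hs.pow_right 2)
  rw [Hat.mul_zpow h, (Hat.commute_zpow (Hat.commute_zpow h.symm σ.m).symm σ.m).eq] at H
  have s1 : SemiconjBy s (s⁻¹ * x * s) x := by change _ = _; group
  have e1 := (semiconj_eval (P := Hat G) σ.f s1 ((Commute.refl s).pow_right 2)).eq
  have e2 := (Hat.semiconj_zpow s1 σ.m).eq
  have e3 := (Hat.commute_zpow ((Commute.refl s).pow_right 2) σ.m).eq
  have e4 := σ.eval_swap (P := Hat G) (s ^ 2) (s⁻¹ * x * s)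
  rw [e4] at H
  rw [zpow_lam]
  generalize eval (P := Hat G) σ.f x (s ^ 2) = e at *
  generalize eval (P := Hat G) σ.f (s⁻¹ * x * s) (s ^ 2) = e' at *
  generalize Hat.zpow x σ.m = X at *
  generalize Hat.zpow (s ^ 2) σ.m = Y at *
  generalize Hat.zpow (s * x * s) σ.m = Z at *
  generalize Hat.zpow (s⁻¹ * x * s) σ.m = W at *
  generalize eval (P := Hat G) σ.f (s⁻¹ * x * s) x = k at *
  have e5 : e⁻¹ * s = s * e'⁻¹ := by
    rw [inv_mul_eq_iff_eq_mul, ← mul_assoc, ← e1]; group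
  have H' : k * W * e'⁻¹ * Y * e = Z := by
    rwa [mul_left_inj] at H
  calc _ = X * (e⁻¹ * (s * Y) * e) := by rw [e3]
    _ = X * (e⁻¹ * s) * Y * e := by simp only [mul_assoc]
    _ = s * W * e'⁻¹ * Y * e := by rw [e5, e2]; simp only [← mul_assoc]
    _ = _ := by rw [← H']; group

lemma hexagon_down (h : Commute x (s * x * s)) :
    (eval (P := Hat G) σ.f x (s ^ 2))⁻¹ * Hat.zpow s σ.lam * eval (P := Hat G) σ.f x (s ^ 2) *
        Hat.zpow x σ.m =
      Hat.zpow (s * x * s) σ.m * eval (P := Hat G) σ.f (s * x * s⁻¹) x * s := by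
  have hc : x * (s * x * s⁻¹) * s ^ 2 = x * (s * x * s) := by rw [pow_two]; group
  have hx : Commute (x * (s * x * s)) x := (Commute.refl x).mul_left h.symm
  have hs : Commute (x * (s * x * s)) s := by
    change x * (s * x * s) * s = s * (x * (s * x * s))
    calc _ = s * x * s * x * s := by rw [h.eq]
      _ = _ := by simp only [mul_assoc]
  have H := σ.hexagon_of_central hc hx ((hs.mul_right hx).mul_right hs.inv_right)
  rw [Hat.mul_zpow h, (Hat.commute_zpow (Hat.commute_zpow h.symm σ.m).symm σ.m).eq] at H
  have s1 : SemiconjBy s x (s * x * s⁻¹) := by change _ = _; group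
  have e1 := (semiconj_eval (P := Hat G) σ.f s1 ((Commute.refl s).pow_right 2)).eq
  have e2 := (Hat.semiconj_zpow s1 σ.m).eq
  rw [σ.eval_swap (P := Hat G) x (s * x * s⁻¹), σ.eval_swap (P := Hat G) (s ^ 2) x] at H
  rw [zpow_lam]
  generalize eval (P := Hat G) σ.f x (s ^ 2) = e at *
  generalize eval (P := Hat G) σ.f (s * x * s⁻¹) (s ^ 2) = e' at *
  generalize Hat.zpow x σ.m = X at *
  generalize Hat.zpow (s ^ 2) σ.m = Y at *
  generalize Hat.zpow (s * x * s) σ.m = Z at *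
  generalize Hat.zpow (s * x * s⁻¹) σ.m = W at *
  generalize eval (P := Hat G) σ.f (s * x * s⁻¹) x = k at *
  have H' : e⁻¹ * Y * e' * W * k⁻¹ = Z := by
    rwa [mul_left_inj] at H
  calc _ = e⁻¹ * Y * (s * e) * X := by simp only [mul_assoc]
    _ = e⁻¹ * Y * e' * (s * X) := by rw [e1]; simp only [mul_assoc]
    _ = _ := by rw [e2, ← H']; group

end Hexagon

end GTHat

/-! ### The action on the cablings of the generators -/

namespace Braid

lemma xBlock_one {N i n : ℕ} (hi : 1 ≤ i) (hN : i + n ≤ N) :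
    xBlock N i n (i + n) 1 = loop N i n := by
  have h : Commute (twist N i n) (loop N i n) :=
    (commute_twist fun j h1 h2 => loop_commute_sigma hi hN h1 h2).symm
  rw [xBlock_eq hi (by omega) rfl, twist_succ, h.eq]
  simp

/-- Conjugation by `up` fixes the full twist of all $n+1$ strings and shifts that of the cable by
one position. -/
lemma up_semiconj_xBlock {N i n : ℕ} (hi : 1 ≤ i) (hN : i + n ≤ N) :
    SemiconjBy (up N i n) (xBlock N i n (i + n) 1) (xBlock N i 1 (i + 1) n) := by
  have h1 : Commute (up N i n) (twist N i (n + 1)) :=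
    (commute_up fun j h1 h2 => twist_commute_sigma hi (by omega) h1 (by omega)).symm
  rw [xBlock_eq hi (by omega) rfl, xBlock_eq hi (by omega) rfl, twist_one, twist_one, add_comm 1 n]
  simpa using SemiconjBy.mul_right h1 (twist_mul_up hi hN).inv_right

lemma down_semiconj_xBlock {N i n : ℕ} (hi : 1 ≤ i) (hN : i + n ≤ N) :
    SemiconjBy (down N i n) (xBlock N i 1 (i + 1) n) (xBlock N i n (i + n) 1) := by
  have h1 : Commute (down N i n) (twist N i (n + 1)) :=
    (commute_down fun j h1 h2 => twist_commute_sigma hi (by omega) h1 (by omega)).symm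
  rw [xBlock_eq hi (by omega) rfl, xBlock_eq hi (by omega) rfl, twist_one, twist_one, add_comm 1 n]
  simpa using SemiconjBy.mul_right h1 (twist_mul_down hi hN).inv_right

lemma up_semiconj_xBlock_succ {N i n : ℕ} (hi : 1 ≤ i) (hN : i + 1 + n ≤ N) :
    SemiconjBy (up N i (n + 1)) (xBlock N i n (i + n) 1) (xBlock N (i + 1) n (i + 1 + n) 1) := by
  rw [xBlock_one hi (by omega), xBlock_one (by omega) hN]
  exact semiconj_loop fun j h1 h2 => up_semiconj hi (by omega) h1 (by omega)

lemma down_semiconj_xBlock_succ {N i n : ℕ} (hi : 1 ≤ i) (hN : i + 1 + n ≤ N) :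
    SemiconjBy (down N i (n + 1)) (xBlock N (i + 1) n (i + 1 + n) 1) (xBlock N i n (i + n) 1) := by
  rw [xBlock_one hi (by omega), xBlock_one (by omega) hN]
  have h : SemiconjBy (down N i (n + 1))⁻¹ (loop N i n) (loop N (i + 1) n) :=
    semiconj_loop fun j h1 h2 => (down_semiconj hi (by omega) h1 (by omega)).inv_symm_left
  simpa using h.inv_symm_left

end Braid

/-! ### Recursion and commutation for the brackets -/

namespace ProfF2

open ProfBraid

variable (f : ProfF2)

lemma bracket_one (N m : ℕ) : bracket f N m 1 = 1 := rfl

lemma bracket_succ (N m : ℕ) {n : ℕ} (hn : 1 ≤ n) :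
    bracket f N m (n + 1) = block f N 1 m n 1 * bracket f N m n := by
  obtain ⟨k, rfl⟩ : ∃ k, n = k + 1 := ⟨n - 1, by omega⟩
  simp [bracket, List.range_succ]

lemma commute_bracket {N m n : ℕ} (hn : 1 ≤ n) (hN : m + n ≤ N) {g : ProfBraid N}
    (h : ∀ t, 1 ≤ t → t < m + n → Commute g (sigma N t)) : Commute g (bracket f N m n) := by
  induction n, hn using Nat.le_induction with
  | base => rw [bracket_one]; exact Commute.one_right g
  | succ n hn ih =>
    rw [bracket_succ f N m hn]
    exact (commute_block f le_rfl (by omega) fun t h1 h2 => h t h1 (by omega)).mul_right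
      (ih (by omega) fun t h1 h2 => h t h1 (by omega))

/-- The first $m$ strings form one block in every factor, and strings beyond $m+n$ are not involved.
-/
lemma sigma_commute_bracket {N m n t : ℕ} (hn : 1 ≤ n) (hN : m + n ≤ N) (ht : 1 ≤ t)
    (h : t < m ∨ m + n < t) : Commute (sigma N t) (bracket f N m n) := by
  induction n, hn using Nat.le_induction with
  | base => rw [bracket_one]; exact Commute.one_right _
  | succ n hn ih =>
    rw [bracket_succ f N m hn]
    exact (sigma_commute_block f le_rfl (by omega) (by omega)).mul_right (ih (by omega) (by omega))

end ProfF2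

namespace GTHat

open ProfF2 ProfBraid

variable (σ : GTHat)

lemma commute_actGen {N i : ℕ} (hi : 1 ≤ i) (hN : i < N) {g : ProfBraid N}
    (h : ∀ t, 1 ≤ t → t ≤ i → Commute g (sigma N t)) : Commute g (actGen σ N i) := by
  have hb : Commute g (block σ.f N 1 (i - 1) 1 1) :=
    commute_block σ.f le_rfl (by omega) fun t h1 h2 => h t h1 (by omega)
  exact (hb.inv_right.mul_right (Hat.commute_zpow (h i hi le_rfl) _)).mul_right hb

section Cabling

variable {N p n : ℕ}

/-- The braid `up N i n` in the profinite braid group. -/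
noncomputable abbrev upHat (N i n : ℕ) : ProfBraid N := Hat.ofGroup _ (Braid.up N i n)

/-- The braid `down N i n` in the profinite braid group. -/
noncomputable abbrev downHat (N i n : ℕ) : ProfBraid N := Hat.ofGroup _ (Braid.down N i n)

lemma xB_succ_one {N i n : ℕ} (hi : 1 ≤ i) (hN : i + n < N) :
    xB N i (n + 1) 1 = sigma N (i + n) * xB N i n 1 * sigma N (i + n) := by
  rw [xB, xB, Braid.xBlock_one hi (by omega), Braid.xBlock_one hi (by omega), Braid.loop_succ,
    map_mul, map_mul, sigma]

/-- The right element is the loop around a cable of $n+1$ strings; the left one is supported on that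
cable, hence inside one block. This is the hypothesis of `hexagon_up` and `hexagon_down`. -/
lemma commute_xB_sigma_mul {N i n : ℕ} (hi : 1 ≤ i) (hN : i + n < N) :
    Commute (xB N i n 1) (sigma N (i + n) * xB N i n 1 * sigma N (i + n)) := by
  rw [← xB_succ_one hi hN]
  exact (commute_xB hi (by omega) fun j h1 h2 =>
    (sigma_commute_xB hi (by omega) (by omega)).symm).symm

/-- Compatibility of the action with the cabling of a crossing by one more string. -/
lemma up_hexagon (hn : 1 ≤ n) (hN : p + 1 + n < N) :
    upHat N (p + 1) n * Hat.zpow (xB N (p + 1) n 1) σ.m *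
        ((block σ.f N (1 + p) n 1 1)⁻¹ * Hat.zpow (sigma N (p + n + 1)) σ.lam *
          block σ.f N (1 + p) n 1 1) =
      (block σ.f N (1 + p) 1 n 1)⁻¹ * upHat N (p + 1) (n + 1) *
        Hat.zpow (xB N (p + 1) (n + 1) 1) σ.m := by
  have H := σ.hexagon_up (commute_xB_sigma_mul (N := N) (i := p + 1) (n := n) (by omega) (by omega))
  have hu : upHat N (p + 1) (n + 1) = upHat N (p + 1) n * sigma N (p + 1 + n) := by
    rw [upHat, Braid.up_succ, map_mul, sigma]
  have s1 : SemiconjBy (upHat N (p + 1) n) (xB N (p + 1) n 1) (xB N (p + 1) 1 n) :=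
    (Braid.up_semiconj_xBlock (by omega) (by omega)).map (Hat.ofGroup _)
  have s2 : SemiconjBy (upHat N (p + 1) (n + 1)) (xB N (p + 1) n 1) (xB N (p + 1 + 1) n 1) :=
    (Braid.up_semiconj_xBlock_succ (by omega) (by omega)).map (Hat.ofGroup _)
  have s3 : SemiconjBy (sigma N (p + 1 + n))
      ((sigma N (p + 1 + n))⁻¹ * xB N (p + 1) n 1 * sigma N (p + 1 + n)) (xB N (p + 1) n 1) := by
    change _ = _; group
  -- Moving $f(s^{-1}xs,x)$ through the longer crossing turns its two arguments into the block
  -- elements of the triple of sizes $1,n,1$.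
  have s4 := s1.mul_left s3
  rw [← hu] at s4
  have e := (semiconj_eval (P := ProfBraid N) σ.f s4 s2).inv_right.eq
  rw [block_of_pos σ.f N (1 + p) (p := n) 1 1 (by omega), block_of_pos σ.f N (1 + p) n 1 one_ne_zero,
    xB_one_one, show 1 + p + n = p + 1 + n by omega, show p + n + 1 = p + 1 + n by omega,
    show 1 + p = p + 1 by omega, mul_assoc (upHat N (p + 1) n), H, ← e,
    xB_succ_one (by omega) (by omega), hu]
  simp only [mul_assoc]

lemma down_hexagon (hn : 1 ≤ n) (hN : p + 1 + n < N) :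
    (block σ.f N (1 + p) n 1 1)⁻¹ * Hat.zpow (sigma N (p + n + 1)) σ.lam *
          block σ.f N (1 + p) n 1 1 * (Hat.zpow (xB N (p + 1) n 1) σ.m * downHat N (p + 1) n) =
      Hat.zpow (xB N (p + 1) (n + 1) 1) σ.m * (downHat N (p + 1) (n + 1) *
        block σ.f N (1 + p) 1 n 1) := by
  have H := σ.hexagon_down
    (commute_xB_sigma_mul (N := N) (i := p + 1) (n := n) (by omega) (by omega))
  have hd : downHat N (p + 1) (n + 1) = sigma N (p + 1 + n) * downHat N (p + 1) n := by
    rw [downHat, Braid.down_succ, map_mul, sigma]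
  have s1 : SemiconjBy (downHat N (p + 1) n) (xB N (p + 1) 1 n) (xB N (p + 1) n 1) :=
    (Braid.down_semiconj_xBlock (by omega) (by omega)).map (Hat.ofGroup _)
  have s2 : SemiconjBy (downHat N (p + 1) (n + 1)) (xB N (p + 1 + 1) n 1) (xB N (p + 1) n 1) :=
    (Braid.down_semiconj_xBlock_succ (by omega) (by omega)).map (Hat.ofGroup _)
  have s3 : SemiconjBy (sigma N (p + 1 + n)) (xB N (p + 1) n 1)
      (sigma N (p + 1 + n) * xB N (p + 1) n 1 * (sigma N (p + 1 + n))⁻¹) := by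
    change _ = _; group
  have s4 := s3.mul_left s1
  rw [← hd] at s4
  have e := (semiconj_eval (P := ProfBraid N) σ.f s4 s2).eq
  rw [block_of_pos σ.f N (1 + p) (p := n) 1 1 (by omega), block_of_pos σ.f N (1 + p) n 1 one_ne_zero,
    xB_one_one, show 1 + p + n = p + 1 + n by omega, show p + n + 1 = p + 1 + n by omega,
    show 1 + p = p + 1 by omega, ← mul_assoc, H, e, xB_succ_one (by omega) (by omega), hd]
  simp only [mul_assoc]

lemma commute_upHat {i : ℕ} {g : ProfBraid N}
    (h : ∀ j, i ≤ j → j < i + n → Commute g (sigma N j)) : Commute g (upHat N i n) := by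
  induction n with
  | zero => rw [upHat, Braid.up_zero, map_one]; exact Commute.one_right g
  | succ n ih =>
    rw [upHat, Braid.up_succ, map_mul]
    exact (ih fun j h1 h2 => h j h1 (by omega)).mul_right (h _ (by omega) (by omega))

lemma commute_downHat {i : ℕ} {g : ProfBraid N}
    (h : ∀ j, i ≤ j → j < i + n → Commute g (sigma N j)) : Commute g (downHat N i n) := by
  induction n with
  | zero => rw [downHat, Braid.down_zero, map_one]; exact Commute.one_right g
  | succ n ih =>
    rw [downHat, Braid.down_succ, map_mul]
    exact (h _ (by omega) (by omega)).mul_right (ih fun j h1 h2 => h j h1 (by omega))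

lemma commute_bracket_actGen (hn : 1 ≤ n) (hN : p + 1 + n < N) :
    Commute (bracket σ.f N p n) (actGen σ N (p + n + 1)) :=
  (commute_bracket σ.f hn (by omega) fun t h1 h2 =>
    (sigma_commute_actGen σ h1 (by omega) (by omega)).symm).symm

lemma sigma_commute_block_middle (hN : p + 1 + n < N) {j : ℕ} (h1 : p + 1 ≤ j)
    (h2 : j < p + 1 + n) : Commute (block σ.f N 1 p (n + 1) 1) (sigma N j) :=
  (sigma_commute_block σ.f le_rfl (by omega) (by omega)).symm

lemma commute_block_zpow (hN : p + 1 + n < N) :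
    Commute (block σ.f N 1 p (n + 1) 1) (Hat.zpow (xB N (p + 1) n 1) σ.m) :=
  Hat.commute_zpow (commute_xB (by omega) (by omega) fun _ h1 h2 =>
    sigma_commute_block_middle σ hN h1 (by omega)) _

lemma pentagon_succ (hn : 1 ≤ n) (hN : p + 1 + n < N) :
    block σ.f N 1 p 1 (n + 1) * block σ.f N 1 (p + 1) n 1 =
      block σ.f N (1 + p) 1 n 1 * block σ.f N 1 p (n + 1) 1 * block σ.f N 1 p 1 n := by
  have := σ.pentagon_block (N := N) (p := p) (q := 1) (r := n) (s := 1) le_rfl hn le_rfl (by omega)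
  rwa [Pentagon, add_comm 1 n] at this

/-- The action on the cabling of `σ_{p+1}`, the string number `p + 1` at the bottom being
replaced. -/
lemma act_upHat (hn : 1 ≤ n) (hN : p + 1 + n ≤ N) :
    σ.act N (upHat N (p + 1) n) = (bracket σ.f N (p + 1) n)⁻¹ * (block σ.f N 1 p 1 n)⁻¹ *
      (upHat N (p + 1) n * Hat.zpow (xB N (p + 1) n 1) σ.m) *
        block σ.f N 1 p n 1 * bracket σ.f N p n := by
  induction n, hn using Nat.le_induction with
  | base =>
    have e : upHat N (p + 1) 1 = sigma N (p + 1) := by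
      rw [upHat, Braid.up_succ, Braid.up_zero, one_mul, sigma, add_zero]
    have := Hat.commute_zpow ((Commute.refl (sigma N (p + 1))).pow_right 2) σ.m
    rw [e, act_sigma σ (by omega) (by omega), actGen, zpow_lam, bracket_one, bracket_one,
      xB_one_one, this.eq, Nat.add_sub_cancel]
    group
  | succ n hn ih =>
    have hu : upHat N (p + 1) (n + 1) = upHat N (p + 1) n * sigma N (p + n + 1) := by
      rw [upHat, Braid.up_succ, map_mul, sigma, add_right_comm]
    -- The last bracket passes across the image of the new generator; then the factor $f$ with
    -- blocks of sizes $p,n,1$ cancels against the conjugator of `actGen_eq`.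
    have hF := (commute_bracket_actGen σ hn hN).eq
    have hP := pentagon_succ σ hn hN
    have H := up_hexagon σ hn hN
    have h1 := (commute_upHat (i := p + 1) (n := n) fun j h1 h2 =>
      sigma_commute_block_middle σ hN h1 h2).inv_left.eq
    have h2 := (commute_block_zpow σ hN).inv_left.eq
    rw [hu, map_mul, ih (by omega), act_sigma σ (by omega) (by omega), mul_assoc _ _ (actGen _ _ _),
      hF, actGen_eq σ hn (by omega), bracket_succ _ _ _ hn, bracket_succ _ _ _ hn, ← hu]
    -- The pentagon trades the accumulated factors for those of the next brackets, leaving `block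
    -- σ.f N (1 + p) 1 n 1`, which cancels the factor produced by the hexagon.
    have hP' : (block σ.f N 1 p 1 n)⁻¹ * (block σ.f N 1 p (n + 1) 1)⁻¹ =
        (block σ.f N 1 (p + 1) n 1)⁻¹ * (block σ.f N 1 p 1 (n + 1))⁻¹ * block σ.f N (1 + p) 1 n 1 := by
      rw [← mul_inv_rev, ← mul_inv_rev, hP]; group
    generalize block σ.f N 1 p 1 n = b2 at *
    generalize block σ.f N 1 p 1 (n + 1) = a2 at *
    generalize block σ.f N 1 (p + 1) n 1 = a1 at *
    generalize block σ.f N 1 p (n + 1) 1 = a3 at *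
    generalize block σ.f N (1 + p) 1 n 1 = h at *
    generalize (block σ.f N (1 + p) n 1 1)⁻¹ * Hat.zpow (sigma N (p + n + 1)) σ.lam *
      block σ.f N (1 + p) n 1 1 = L at *
    generalize upHat N (p + 1) n = β at *
    generalize Hat.zpow (xB N (p + 1) n 1) σ.m = X at *
    calc _ = (bracket σ.f N (p + 1) n)⁻¹ * b2⁻¹ * β * (X * a3⁻¹) * L * a3 *
          block σ.f N 1 p n 1 * bracket σ.f N p n := by group
      _ = (bracket σ.f N (p + 1) n)⁻¹ * b2⁻¹ * (β * a3⁻¹) * X * L * a3 *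
          block σ.f N 1 p n 1 * bracket σ.f N p n := by rw [← h2]; simp only [mul_assoc]
      _ = (bracket σ.f N (p + 1) n)⁻¹ * (b2⁻¹ * a3⁻¹) * (β * X * L) * a3 *
          block σ.f N 1 p n 1 * bracket σ.f N p n := by rw [← h1]; simp only [mul_assoc]
      _ = _ := by rw [H, hP']; group

/-- The action on the cabling of `σ_{p+1}`, the string number `p + 1` at the top being
replaced. -/
lemma act_downHat (hn : 1 ≤ n) (hN : p + 1 + n ≤ N) :
    σ.act N (downHat N (p + 1) n) = (bracket σ.f N p n)⁻¹ * (block σ.f N 1 p n 1)⁻¹ *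
      (Hat.zpow (xB N (p + 1) n 1) σ.m * downHat N (p + 1) n) *
        block σ.f N 1 p 1 n * bracket σ.f N (p + 1) n := by
  induction n, hn using Nat.le_induction with
  | base =>
    have e : downHat N (p + 1) 1 = sigma N (p + 1) := by
      rw [downHat, Braid.down_succ, Braid.down_zero, mul_one, sigma, add_zero]
    rw [e, act_sigma σ (by omega) (by omega), actGen, zpow_lam, bracket_one, bracket_one,
      xB_one_one, Nat.add_sub_cancel]
    group
  | succ n hn ih =>
    have hd : downHat N (p + 1) (n + 1) = sigma N (p + n + 1) * downHat N (p + 1) n := by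
      rw [downHat, Braid.down_succ, map_mul, sigma, add_right_comm]
    have hF := (commute_bracket_actGen σ hn hN).inv_left.eq
    have hP := pentagon_succ σ hn hN
    have H := down_hexagon σ hn hN
    have h1 := (commute_downHat (i := p + 1) (n := n) fun j h1 h2 =>
      sigma_commute_block_middle σ hN h1 h2).eq
    have h2 := (commute_block_zpow σ hN).eq
    rw [hd, map_mul, ih (by omega), act_sigma σ (by omega) (by omega), bracket_succ _ _ _ hn,
      bracket_succ _ _ _ hn, ← hd]
    simp only [← mul_assoc]
    -- Mirror of `act_upHat`: the new generator stands on the left, so the inverse bracket moves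
    -- left past its image, and the pentagon is applied on the right of the crossing.
    rw [← hF, actGen_eq σ hn (by omega)]
    generalize block σ.f N 1 p 1 n = b2 at *
    generalize block σ.f N 1 p 1 (n + 1) = a2 at *
    generalize block σ.f N 1 (p + 1) n 1 = a1 at *
    generalize block σ.f N 1 p (n + 1) 1 = a3 at *
    generalize block σ.f N (1 + p) 1 n 1 = h at *
    generalize (block σ.f N (1 + p) n 1 1)⁻¹ * Hat.zpow (sigma N (p + n + 1)) σ.lam *
      block σ.f N (1 + p) n 1 1 = L at *
    generalize downHat N (p + 1) n = β at *
    generalize Hat.zpow (xB N (p + 1) n 1) σ.m = X at *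
    calc _ = (bracket σ.f N p n)⁻¹ * (block σ.f N 1 p n 1)⁻¹ * a3⁻¹ * L * (a3 * X) * β * b2 *
          bracket σ.f N (p + 1) n := by group
      _ = (bracket σ.f N p n)⁻¹ * (block σ.f N 1 p n 1)⁻¹ * a3⁻¹ * L * X * (a3 * β) * b2 *
          bracket σ.f N (p + 1) n := by rw [h2]; simp only [mul_assoc]
      _ = (bracket σ.f N p n)⁻¹ * (block σ.f N 1 p n 1)⁻¹ * a3⁻¹ * (L * (X * β)) * a3 * b2 *
          bracket σ.f N (p + 1) n := by rw [h1]; simp only [mul_assoc]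
      _ = (bracket σ.f N p n)⁻¹ * (block σ.f N 1 p n 1)⁻¹ * a3⁻¹ *
          Hat.zpow (xB N (p + 1) (n + 1) 1) σ.m * downHat N (p + 1) (n + 1) * (h * a3 * b2) *
          bracket σ.f N (p + 1) n := by rw [H]; simp only [mul_assoc]
      _ = _ := by rw [← hP]; group

end Cabling

end GTHat

/-! ### The action and cabling -/

namespace ProfBraid

lemma cable_right {l n : ℕ} (hn : 1 ≤ n) (b : ProfBraid l) :
    (cable l n hn b).right = toPerm l b := by
  let _ : TopologicalSpace (Equiv.Perm (Fin l)) := ⊥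
  have _ : DiscreteTopology (Equiv.Perm (Fin l)) := ⟨rfl⟩
  refine Hat.eq_of_eqOn_ofGroup (φ := fun b => (cable l n hn b).right) (ψ := fun b => toPerm l b)
    ((Cables.continuous_right l _).comp (cable l n hn).continuous_toFun)
    (Hat.extend (P := ProfiniteGrp.ofFiniteGrp (FiniteGrp.of (Equiv.Perm (Fin l))))
      (Braid.toPerm l)).continuous_toFun (fun w => ?_) b
  have h : toPerm l (Hat.ofGroup _ w) = Braid.toPerm l w :=
    Hat.extend_ofGroup (P := ProfiniteGrp.ofFiniteGrp (FiniteGrp.of (Equiv.Perm (Fin l)))) _ w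
  change (cable l n hn (Hat.ofGroup _ w)).right = _
  rw [h, cable_ofGroup]
  refine DFunLike.congr_fun (?_ : SemidirectProduct.rightHom.comp (Braid.cable l n hn) =
    Braid.toPerm l) w
  refine PresentedGroup.ext fun i => ?_
  change (Braid.cable l n hn (PresentedGroup.of i)).right = Braid.toPerm l (PresentedGroup.of i)
  rw [show Braid.cable l n hn (PresentedGroup.of i) = Braid.cableGen l n i from
      PresentedGroup.toGroup.of _,
    show Braid.toPerm l (PresentedGroup.of i) = Braid.swapAt l i from PresentedGroup.toGroup.of _]
  rfl

lemma cable_zpow {l n : ℕ} (hn : 1 ≤ n) {g : ProfBraid l} {u : Fin l → ProfBraid (l + n - 1)}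
    (hg : cable l n hn g = SemidirectProduct.inl u) (c : ZHat) :
    cable l n hn (Hat.zpow g c) =
      SemidirectProduct.inl fun j => Hat.zpow (G := Braid (l + n - 1)) (u j) c := by
  refine tendsto_nhds_unique
    (((cable l n hn).continuous_toFun.tendsto _).comp (Hat.tendsto_pow_approx g c)) ?_
  refine ((Cables.continuous_inl.tendsto _).comp (tendsto_pi_nhds.2 fun j =>
    Hat.tendsto_pow_approx (G := Braid (l + n - 1)) (u j) c)).congr fun L => ?_
  exact ((map_pow (cable l n hn) g _).trans (by rw [hg, ← map_pow]; rfl)).symm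

end ProfBraid

namespace Cables

lemma continuous_map (l : ℕ) {H K : Type} [Group H] [Group K] [TopologicalSpace H]
    [TopologicalSpace K] {φ : H →* K} (hφ : Continuous φ) : Continuous (map l φ) :=
  letI : TopologicalSpace (Equiv.Perm (Fin l)) := ⊥
  continuous_induced_rng.2 (Continuous.prodMk
    (continuous_pi fun j => hφ.comp ((continuous_apply j).comp (continuous_left l H)))
    (continuous_right l H))

end Cables

namespace GTHat

open ProfF2 ProfBraid

variable (σ : GTHat)

/-- The action on the cablings of the generators. -/
lemma act_cableSigma {l n : ℕ} (hn : 1 ≤ n) (i : {i : ℕ // 1 ≤ i ∧ i < l}) (j : Fin l) :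
    σ.act (l + n - 1) (Hat.ofGroup _ (Braid.cableSigma l n i j)) =
      (bracket σ.f (l + n - 1) j n)⁻¹ *
        (block σ.f (l + n - 1) (startCable n (j + 1) 1) (sizeCable n (j + 1) 1 (i - 1))
          (sizeCable n (j + 1) (1 + (i - 1)) 1) (sizeCable n (j + 1) (1 + (i - 1) + 1) 1))⁻¹ *
        (Hat.zpow (xB (l + n - 1) (startCable n (j + 1) i) (sizeCable n (j + 1) i 1)
          (sizeCable n (j + 1) (i + 1) 1)) σ.m *
        Hat.ofGroup _ (Braid.cableSigma l n i j)) *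
        block σ.f (l + n - 1) (startCable n (Braid.swapAt l i j + 1) 1)
          (sizeCable n (Braid.swapAt l i j + 1) 1 (i - 1))
          (sizeCable n (Braid.swapAt l i j + 1) (1 + (i - 1)) 1)
          (sizeCable n (Braid.swapAt l i j + 1) (1 + (i - 1) + 1) 1) *
        bracket σ.f (l + n - 1) (Braid.swapAt l i j) n := by
  obtain ⟨i, hi⟩ := i
  obtain ⟨p, rfl⟩ : ∃ p, i = p + 1 := ⟨i - 1, by omega⟩
  have hj := j.2
  have e1 : ∀ k, startCable n (k + 1) 1 = 1 := fun k => by simp [startCable]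
  rcases lt_trichotomy ((j : ℕ) + 1) (p + 1) with h | h | h
  · have hs := Braid.swapAt_val_of_lt (i := ⟨p + 1, hi⟩) h
    -- The cabled string is left of the crossing: the bracket only uses strings lying in the first
    -- block of the conjugator and away from the crossing.
    have hc : Commute (bracket σ.f (l + n - 1) j n) (actGen σ (l + n - 1) (p + 1 + n - 1)) :=
      (commute_bracket σ.f hn (by omega) fun t h1 h2 =>
        (sigma_commute_actGen σ h1 (by omega) (by omega)).symm).symm
    rw [Braid.cableSigma_of_lt h, hs, e1]
    simp only [Nat.add_sub_cancel]
    rw [show sizeCable n (j + 1) 1 p = p + n - 1 by rw [sizeCable, if_pos]; omega,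
      show sizeCable n (j + 1) (1 + p) 1 = 1 by rw [sizeCable, if_neg]; omega,
      show sizeCable n (j + 1) (1 + p + 1) 1 = 1 by rw [sizeCable, if_neg]; omega,
      show startCable n (j + 1) (p + 1) = p + 1 + n - 1 by rw [startCable, if_pos h],
      show sizeCable n (j + 1) (p + 1) 1 = 1 by rw [sizeCable, if_neg]; omega,
      show sizeCable n (j + 1) (p + 1 + 1) 1 = 1 by rw [sizeCable, if_neg]; omega, xB_one_one]
    refine (act_sigma σ (by omega) (by omega)).trans ?_
    change _ = _ * _⁻¹ * (_ * sigma (l + n - 1) (p + 1 + n - 1)) * _ * _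
    rw [← zpow_lam]
    rw [actGen, show p + 1 + n - 1 - 1 = p + n - 1 by omega] at hc ⊢
    refine (eq_inv_mul_of_mul_eq hc.eq).trans ?_
    simp only [mul_assoc]
  · have hs := Braid.swapAt_val_left (i := ⟨p + 1, hi⟩) h
    simp only at hs
    rw [Braid.cableSigma_left h, hs, e1, e1, show (j : ℕ) = p by omega]
    simp only [Nat.add_sub_cancel]
    rw [show sizeCable n (p + 1) 1 p = p by rw [sizeCable, if_neg]; omega,
      show sizeCable n (p + 1) (1 + p) 1 = n by rw [sizeCable, if_pos] <;> omega,
      show sizeCable n (p + 1) (1 + p + 1) 1 = 1 by rw [sizeCable, if_neg]; omega,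
      show startCable n (p + 1) (p + 1) = p + 1 by simp [startCable],
      show sizeCable n (p + 1) (p + 1) 1 = n by rw [sizeCable, if_pos] <;> omega,
      show sizeCable n (p + 1) (p + 1 + 1) 1 = 1 by rw [sizeCable, if_neg]; omega,
      show sizeCable n (p + 1 + 1) 1 p = p by rw [sizeCable, if_neg]; omega,
      show sizeCable n (p + 1 + 1) (1 + p) 1 = 1 by rw [sizeCable, if_neg]; omega,
      show sizeCable n (p + 1 + 1) (1 + p + 1) 1 = n by rw [sizeCable, if_pos] <;> omega]
    exact act_downHat σ hn (by omega)
  · rcases eq_or_lt_of_le (show p + 1 ≤ (j : ℕ) by omega) with h' | h'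
    · have hs := Braid.swapAt_val_right (i := ⟨p + 1, hi⟩) h'.symm
      simp only [Nat.add_right_cancel_iff] at hs
      rw [Braid.cableSigma_right h'.symm, hs, e1, e1, ← h']
      simp only [Nat.add_sub_cancel]
      rw [show sizeCable n (p + 1) 1 p = p by rw [sizeCable, if_neg]; omega,
        show sizeCable n (p + 1) (1 + p) 1 = n by rw [sizeCable, if_pos] <;> omega,
        show sizeCable n (p + 1) (1 + p + 1) 1 = 1 by rw [sizeCable, if_neg]; omega,
        show startCable n (p + 1 + 1) (p + 1) = p + 1 by simp [startCable],
        show sizeCable n (p + 1 + 1) (p + 1) 1 = 1 by rw [sizeCable, if_neg]; omega,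
        show sizeCable n (p + 1 + 1) (p + 1 + 1) 1 = n by rw [sizeCable, if_pos] <;> omega,
        show sizeCable n (p + 1 + 1) 1 p = p by rw [sizeCable, if_neg]; omega,
        show sizeCable n (p + 1 + 1) (1 + p) 1 = 1 by rw [sizeCable, if_neg]; omega,
        show sizeCable n (p + 1 + 1) (1 + p + 1) 1 = n by rw [sizeCable, if_pos] <;> omega]
      -- `act_upHat` has the pure power to the right of the crossing; moving it to the left
      -- interchanges the block sizes.
      have hx : SemiconjBy (upHat (l + n - 1) (p + 1) n) (xB (l + n - 1) (p + 1) n 1)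
          (xB (l + n - 1) (p + 1) 1 n) :=
        (Braid.up_semiconj_xBlock (by omega) (by omega)).map (Hat.ofGroup _)
      have := act_upHat σ (N := l + n - 1) (p := p) hn (by omega)
      rw [(Hat.semiconj_zpow hx σ.m).eq] at this
      exact this
    · have hs := Braid.swapAt_val_of_gt (i := ⟨p + 1, hi⟩) h'
      -- The cabled string is right of the crossing: the image of the generator only uses strings in
      -- the first block of every factor of the bracket.
      have hc : Commute (bracket σ.f (l + n - 1) j n) (actGen σ (l + n - 1) (p + 1)) :=
        commute_actGen σ (by omega) (by omega) fun t h1 h2 =>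
          (sigma_commute_bracket σ.f hn (by omega) h1 (by omega)).symm
      rw [Braid.cableSigma_of_gt h', hs, e1]
      simp only [Nat.add_sub_cancel]
      rw [show sizeCable n (j + 1) 1 p = p by rw [sizeCable, if_neg]; omega,
        show sizeCable n (j + 1) (1 + p) 1 = 1 by rw [sizeCable, if_neg]; omega,
        show sizeCable n (j + 1) (1 + p + 1) 1 = 1 by rw [sizeCable, if_neg]; omega,
        show startCable n (j + 1) (p + 1) = p + 1 by rw [startCable, if_neg]; omega,
        show sizeCable n (j + 1) (p + 1) 1 = 1 by rw [sizeCable, if_neg]; omega,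
        show sizeCable n (j + 1) (p + 1 + 1) 1 = 1 by rw [sizeCable, if_neg]; omega, xB_one_one]
      refine (act_sigma σ (by omega) (by omega)).trans ?_
      change _ = _ * _⁻¹ * (_ * sigma (l + n - 1) (p + 1)) * _ * _
      rw [← zpow_lam]
      rw [actGen, Nat.add_sub_cancel] at hc ⊢
      refine (eq_inv_mul_of_mul_eq hc.eq).trans ?_
      simp only [mul_assoc]

/-- The action commutes with all the cablings, up to the elements `f_{[m₁],[n],[m₂]}`. -/
lemma map_act_cable {l n : ℕ} (hn : 1 ≤ n) (b : ProfBraid l) :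
    Cables.map l (σ.act (l + n - 1)).toMonoidHom (cable l n hn b) =
      (SemidirectProduct.inl fun j : Fin l => bracket σ.f (l + n - 1) j n)⁻¹ *
        cable l n hn (σ.act l b) *
          SemidirectProduct.inl fun j : Fin l => bracket σ.f (l + n - 1) j n := by
  set F : Cables l (ProfBraid (l + n - 1)) :=
    SemidirectProduct.inl fun j : Fin l => bracket σ.f (l + n - 1) j n with hF
  let Φ : ProfBraid l →* Cables l (ProfBraid (l + n - 1)) :=
    (Cables.map l (σ.act (l + n - 1)).toMonoidHom).comp (cable l n hn).toMonoidHom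
  let Ψ : ProfBraid l →* Cables l (ProfBraid (l + n - 1)) :=
    (MulAut.conj F⁻¹).toMonoidHom.comp ((cable l n hn).toMonoidHom.comp (σ.act l).toMonoidHom)
  have hΨ : ∀ b, Ψ b = F⁻¹ * cable l n hn (σ.act l b) * F := fun b => by
    change F⁻¹ * _ * F⁻¹⁻¹ = _
    rw [inv_inv]; rfl
  have cΦ : Continuous Φ := (Cables.continuous_map l (σ.act (l + n - 1)).continuous_toFun).comp
    (cable l n hn).continuous_toFun
  have cΨ : Continuous Ψ := by
    have h : Continuous fun b => F⁻¹ * cable l n hn (σ.act l b) * F :=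
      (continuous_const.mul ((cable l n hn).continuous_toFun.comp
        (σ.act l).continuous_toFun)).mul continuous_const
    exact h.congr fun b => (hΨ b).symm
  rw [← hΨ]
  refine Hat.eq_of_eqOn_ofGroup (φ := Φ) (ψ := Ψ) cΦ cΨ (fun w => ?_) b
  refine DFunLike.congr_fun (?_ : Φ.comp (Hat.ofGroup _) = Ψ.comp (Hat.ofGroup _)) w
  refine PresentedGroup.ext fun i => ?_
  have hi : (PresentedGroup.of i : Braid l) = Braid.sigma l i := by
    rw [Braid.sigma, dif_pos i.2]
  change Cables.map l _ (cable l n hn (Hat.ofGroup _ (PresentedGroup.of i))) =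
    Ψ (Hat.ofGroup _ (PresentedGroup.of i))
  rw [hi, hΨ]
  change _ = F⁻¹ * cable l n hn (σ.act l (sigma l i)) * F
  have hσ : cable l n hn (sigma l i) = Cables.map l (Hat.ofGroup _) (Braid.cableGen l n i) := by
    rw [sigma, cable_ofGroup, Braid.cable_sigma hn i.2]
  have hB := cable_block σ.f hn (l := l) (a := 1) (p := i - 1) (q := 1) (r := 1) le_rfl
    (by have := i.2; omega)
  have hX := cable_zpow hn (cable_xB hn (l := l) (a := i) (p := 1) (q := 1) i.2.1
    (by have := i.2; omega)) σ.m
  change Cables.map l _ (cable l n hn (sigma l i)) = _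
  -- With $\sigma_i^\lambda=x_{i,i+1}^m\sigma_i$, every factor except the last crossing is pure, so
  -- its cabling lies in the base group and is given by `hB` and `hX`.
  rw [act_sigma σ i.2.1 i.2.2, actGen, map_mul, map_mul, map_inv, zpow_lam, map_mul, ← xB_one_one,
    hB, hX, hσ]
  refine SemidirectProduct.ext (funext fun j => ?_) ?_
  · have := act_cableSigma σ hn i j
    refine Eq.trans (?_ : _ = σ.act (l + n - 1) (Hat.ofGroup _ (Braid.cableSigma l n i j))) ?_
    · rfl
    · rw [this]
      -- The semidirect product evaluates the right-hand bracket at the inverse permutation of `j`;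
      -- a transposition is its own inverse.
      rw [show Braid.swapAt l i j = (Braid.swapAt l i)⁻¹ j by rw [Braid.swapAt, Equiv.swap_inv], hF]
      simp only [mul_assoc, ← map_inv]
      rfl
  · simp [hF, Cables.map, Braid.cableGen]

end GTHat

theorem mainTheorem9 (σ : GTHat) :
    (∀ N : ℕ, σ.IsAction N (σ.act N)) ∧
    ∀ (l n : ℕ) (hn : 1 ≤ n) (k : Fin l) (b : ProfBraid l) (k' : Fin l),
      k' = ProfBraid.toPerm l b k →
      σ.act (l + n - 1) (ProfBraid.evBot l n hn k b) =
          (ProfF2.bracket σ.f (l + n - 1) k' n)⁻¹ * ProfBraid.evBot l n hn k (σ.act l b) *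
            ProfF2.bracket σ.f (l + n - 1) k n ∧
      σ.act (l + n - 1) (ProfBraid.evTop l n hn k' b) =
          (ProfF2.bracket σ.f (l + n - 1) k' n)⁻¹ * ProfBraid.evTop l n hn k' (σ.act l b) *
            ProfF2.bracket σ.f (l + n - 1) k n := by
  refine ⟨σ.isAction_act, fun l n hn k b k' hk => ?_⟩
  have h := σ.map_act_cable hn b
  have hr := congrArg SemidirectProduct.right h
  -- Conjugation by a base element does not change the permutation component, and neither does a map
  -- acting on the components.
  have hp : ProfBraid.toPerm l (σ.act l b) = ProfBraid.toPerm l b := by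
    rw [← ProfBraid.cable_right hn, ← ProfBraid.cable_right hn]
    simpa [Cables.map] using hr.symm
  have main : σ.act (l + n - 1) (ProfBraid.evTop l n hn k' b) =
      (ProfF2.bracket σ.f (l + n - 1) k' n)⁻¹ * ProfBraid.evTop l n hn k' (σ.act l b) *
        ProfF2.bracket σ.f (l + n - 1) k n := by
    have hl := congrArg (fun c => c.left k') h
    rw [← map_inv] at hl
    have hl' : σ.act (l + n - 1) (ProfBraid.evTop l n hn k' b) =
        (ProfF2.bracket σ.f (l + n - 1) k' n)⁻¹ * ProfBraid.evTop l n hn k' (σ.act l b) *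
          ProfF2.bracket σ.f (l + n - 1)
            ((ProfBraid.cable l n hn (σ.act l b)).right⁻¹ k' : Fin l) n := hl
    rwa [ProfBraid.cable_right, hp, hk, show (ProfBraid.toPerm l b)⁻¹ (ProfBraid.toPerm l b k) = k
      from Equiv.symm_apply_apply _ _, ← hk] at hl'
  refine ⟨?_, main⟩
  rw [ProfBraid.evBot, ProfBraid.evBot, hp, ← hk]
  exact main
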